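/- Let $n\ge 1$ and let $\mathbb{H}^n$ be $n$-dimensional hyperbolic space (curvature $-1$) with its geodesic distance $d$ and its hyperbolic volume $\mathrm{vol}$. Fix an origin $0\in\mathbb{H}^n$, and for $r\ge 0$ let $B_r(0)=\{x\in\mathbb{H}^n : d(0,x)\le r\}$. Fix $R>0$. For a convex set $X\subseteq B_R(0)$ (that is, a set containing the geodesic segment $[s,t]$ whenever it contains $s$ and $t$), the normalized traffic load of $X$ is $$\lambda_t(X)=\frac{1}{\mathrm{vol}(B_R(0))^2}\iint_{B_R(0)\times B_R(0)}\ell\bigl(X\cap[s,t]\bigr)\,d\mathrm{vol}(s)\,d\mathrm{vol}(t),$$ where $[s,t]$ is the geodesic segment from $s$ to $t$ and $\ell$ denotes hyperbolic length. Then, among the convex subsets of $B_R(0)$ of prescribed volume, $\lambda_t$ attains its maximum at a ball centered at the origin: for every $v$ with $0\le v\le\mathrm{vol}(B_R(0))$ there is $r\in[0,R]$ such that $B_r(0)$ is a convex subset of $B_R(0)$ with $\mathrm{vol}(B_r(0))=v$, and $$\lambda_t(X)\le\lambda_t(B_r(0))\quad\text{for every convex } X\subseteq B_R(0) \text{ with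 } \mathrm{vol}(X)=v.$$ -/

import Mathlib

open MeasureTheory
open scoped ENNReal

noncomputable section

/-- The underlying set of hyperbolic `n`-space `ℍⁿ` (curvature `-1`) in the Beltrami–Klein model:
the open unit ball of `ℝⁿ`, with the Riemannian metric
`ds² = |dx|² / (1 - |x|²) + ⟨x, dx⟩² / (1 - |x|²)²`. -/
def hypSpace (n : ℕ) : Set (EuclideanSpace ℝ (Fin n)) :=
  Metric.ball 0 1

/-- The hyperbolic distance of `ℍⁿ` in the Klein model:
`cosh d(x, y) = (1 - ⟨x, y⟩) / (√(1 - |x|²) √(1 - |y|²))`.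
(The point `x` of the model stands for the point `(1, x) / √(1 - |x|²)` of the hyperboloid.) -/
def hypDist {n : ℕ} (x y : EuclideanSpace ℝ (Fin n)) : ℝ :=
  Real.arcosh ((1 - inner ℝ x y) / (Real.sqrt (1 - ‖x‖ ^ 2) * Real.sqrt (1 - ‖y‖ ^ 2)))

/-- The hyperbolic (Riemannian) volume of `ℍⁿ` in the Klein model. The determinant of the metric
tensor at `x` is `(1 - |x|²) ^ (-(n + 1))`, so that `dvol = (1 - |x|²) ^ (-(n + 1) / 2) dx`. -/
def hypVolume (n : ℕ) : Measure (EuclideanSpace ℝ (Fin n)) :=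
  (volume.restrict (hypSpace n)).withDensity
    (fun x => ENNReal.ofReal ((1 - ‖x‖ ^ 2) ^ (-((n : ℝ) + 1) / 2)))

/-- The (closed) hyperbolic ball `B_r(0)` of radius `r` centered at the origin of `ℍⁿ`. -/
def hypBall (n : ℕ) (r : ℝ) : Set (EuclideanSpace ℝ (Fin n)) :=
  {x | x ∈ hypSpace n ∧ hypDist 0 x ≤ r}

/-- The geodesic segment `[s, t]` of `ℍⁿ`: the points `z` that lie on a shortest path from `s`
to `t`, that is, with `d(s, z) + d(z, t) = d(s, t)`. -/
def geodSegment {n : ℕ} (s t : EuclideanSpace ℝ (Fin n)) : Set (EuclideanSpace ℝ (Fin n)) :=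
  {z | z ∈ hypSpace n ∧ hypDist s z + hypDist z t = hypDist s t}

/-- A set of points of `ℍⁿ` is convex if it contains the geodesic segment between any two of its
points. -/
def IsHypConvex {n : ℕ} (X : Set (EuclideanSpace ℝ (Fin n))) : Prop :=
  X ⊆ hypSpace n ∧ ∀ s ∈ X, ∀ t ∈ X, geodSegment s t ⊆ X

/-- The length `ℓ(X ∩ [s, t])`. The distance `z ↦ d(s, z)` from `s` is the arc length parameter of
the geodesic segment `[s, t]`, and the length is the Lebesgue measure of the set of parameters of
the points of `X ∩ [s, t]`. -/
def lengthInter {n : ℕ} (X : Set (EuclideanSpace ℝ (Fin n))) (s t : EuclideanSpace ℝ (Fin n)) :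
    ℝ≥0∞ :=
  volume ((fun z => hypDist s z) '' (X ∩ geodSegment s t))

/-- The traffic load `Λ_t(X) = ∬_{B_R(0) × B_R(0)} ℓ(X ∩ [s, t]) dvol(s) dvol(t)`. -/
def trafficLoad (n : ℕ) (R : ℝ) (X : Set (EuclideanSpace ℝ (Fin n))) : ℝ≥0∞ :=
  ∫⁻ p in hypBall n R ×ˢ hypBall n R, lengthInter X p.1 p.2 ∂((hypVolume n).prod (hypVolume n))

/-- The normalized traffic load `λ_t(X) = Λ_t(X) / vol(B_R(0))²`. -/
def normalizedTrafficLoad (n : ℕ) (R : ℝ) (X : Set (EuclideanSpace ℝ (Fin n))) : ℝ≥0∞ :=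
  trafficLoad n R X / hypVolume n (hypBall n R) ^ 2

/-- The convex subsets of `B_R(0) ⊂ ℍⁿ` of hyperbolic volume `v`. -/
def convexSubsetsOfVolume (n : ℕ) (R : ℝ) (v : ℝ≥0∞) : Set (Set (EuclideanSpace ℝ (Fin n))) :=
  {X | IsHypConvex X ∧ X ⊆ hypBall n R ∧ hypVolume n X = v}

end

/-! By Fubini, the load of a measurable set `X` is the integral over `X` of a density: at `z` it
measures the pairs `(s, t)` in `B_R(0)` whose segment passes through `z`. The substitution `(s, t) ↦
(z, v) = (s + τ(t - s), t - s)` makes this precise (`trafficLoad_eq_lintegral_hypLoadDensity`). It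
is available because Klein geodesics are straight segments. The claim then reduces to the bathtub
principle, once the density with respect to hyperbolic volume is known to be radial and
nonincreasing in the distance from the origin.

Radiality is rotation invariance. For monotonicity, use hyperbolic polar coordinates at `z = p e`:
the density is the integral, over directions `u` and chord lengths `q`, of `sinh q ^ (n - 1)` times
the length of the set of positions that `z` can take on a chord of length `q` in direction `u` with
both endpoints in `B_R(0)` (`hypLoadDensity_smul_eq`). The line through `z` in direction `u` meets
`B_R(0)` in a chord of half-length `C` whose midpoint, the foot of the perpendicular from the
origin, is at distance `|m|` from `z`, where `tanh m = p ⟨e, u⟩` and `cosh C = √(1 - p²) cosh R cosh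
m`. Moving `z` outward with `⟨e, u⟩` fixed increases `|m|` and shrinks `C`; both leave less room for
the segment (`chordPositions_anti`). So the comparison holds already for the integrands.

The radius `r` comes from the intermediate value theorem applied to the volume of balls. -/

noncomputable section KleinMetric

/-! ### Algebra of the Klein metric -/

variable {V : Type*} [NormedAddCommGroup V]

/-- The quantity `1 - |x|²`, positive exactly on the Klein ball. -/
def kleinGap (x : V) : ℝ := 1 - ‖x‖ ^ 2

theorem kleinGap_pos {x : V} (hx : ‖x‖ < 1) : 0 < kleinGap x := by
  unfold kleinGap; nlinarith [norm_nonneg x]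

theorem kleinGap_pos_iff {x : V} : 0 < kleinGap x ↔ ‖x‖ < 1 := by
  refine ⟨fun h => ?_, kleinGap_pos⟩
  unfold kleinGap at h; nlinarith [norm_nonneg x]

variable [InnerProductSpace ℝ V]

/-- The quantity `√(|v|² (1 - |z|²) + ⟨z, v⟩²)`: the hyperbolic norm of the tangent vector `v` at
`z` is `kleinSpeed z v / kleinGap z`. -/
def kleinSpeed (z v : V) : ℝ := √(‖v‖ ^ 2 * kleinGap z + inner ℝ z v ^ 2)

theorem kleinGap_add_smul (z v : V) (τ : ℝ) :
    kleinGap (z + τ • v) = kleinGap z - 2 * τ * inner ℝ z v - τ ^ 2 * ‖v‖ ^ 2 := by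
  simp only [kleinGap, norm_add_sq_real, inner_smul_right, norm_smul, mul_pow, Real.norm_eq_abs,
    sq_abs]
  ring

theorem kleinSpeed_sq {z : V} (v : V) (hz : ‖z‖ < 1) :
    kleinSpeed z v ^ 2 = ‖v‖ ^ 2 * kleinGap z + inner ℝ z v ^ 2 :=
  Real.sq_sqrt (by have := kleinGap_pos hz; positivity)

theorem kleinSpeed_nonneg (z v : V) : 0 ≤ kleinSpeed z v := Real.sqrt_nonneg _

theorem kleinSpeed_pos {z v : V} (hz : ‖z‖ < 1) (hv : v ≠ 0) : 0 < kleinSpeed z v := by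
  have := kleinGap_pos hz
  have := norm_pos_iff.2 hv
  exact Real.sqrt_pos.2 (by positivity)

theorem kleinSpeed_zero (z : V) : kleinSpeed z 0 = 0 := by simp [kleinSpeed]

/-- The square of `kleinSpeed z v` is a quarter of the discriminant of the quadratic `τ ↦ kleinGap
(z + τ • v)`, and shifting the variable preserves a discriminant. -/
theorem kleinSpeed_add_smul (z v : V) (τ : ℝ) : kleinSpeed (z + τ • v) v = kleinSpeed z v := by
  unfold kleinSpeed
  congr 1
  simp only [kleinGap_add_smul, inner_add_left, real_inner_smul_left, real_inner_self_eq_norm_sq]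
  ring

theorem kleinSpeed_smul (z v : V) {c : ℝ} (hc : 0 ≤ c) :
    kleinSpeed z (c • v) = c * kleinSpeed z v := by
  unfold kleinSpeed
  rw [← Real.sqrt_sq hc, ← Real.sqrt_mul (by positivity), Real.sqrt_sq hc]
  congr 1
  simp only [norm_smul, inner_smul_right, mul_pow, Real.norm_eq_abs, sq_abs]
  ring

theorem kleinSpeed_neg (z v : V) : kleinSpeed z (-v) = kleinSpeed z v := by
  simp [kleinSpeed]

/-- Divided by the two gaps this is `sinh² = cosh² - 1` for the distance from `x` to `y`; in
Minkowski space it is a Gram determinant of `(1, x)` and `(1, y)`, up to sign. -/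
theorem kleinSpeed_sub_sq {x : V} (y : V) (hx : ‖x‖ < 1) :
    kleinSpeed x (y - x) ^ 2 = (1 - inner ℝ x y) ^ 2 - kleinGap x * kleinGap y := by
  rw [kleinSpeed_sq _ hx]
  simp only [kleinGap, norm_sub_sq_real, inner_sub_right, real_inner_self_eq_norm_sq,
    real_inner_comm x y]
  ring

theorem one_sub_inner_pos {x y : V} (hx : ‖x‖ < 1) (hy : ‖y‖ < 1) : 0 < 1 - inner ℝ x y := by
  have := real_inner_le_norm x y
  nlinarith [norm_nonneg x, norm_nonneg y]

end KleinMetric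

/-! ### Distance, geodesic segments and balls in the Klein model -/

section HypDist

variable {n : ℕ} {x y z s t : EuclideanSpace ℝ (Fin n)}

theorem mem_hypSpace_iff : x ∈ hypSpace n ↔ ‖x‖ < 1 := by simp [hypSpace]

theorem one_le_cosh_ratio (hx : ‖x‖ < 1) (hy : ‖y‖ < 1) :
    1 ≤ (1 - inner ℝ x y) / (√(kleinGap x) * √(kleinGap y)) := by
  have h1 := Real.sqrt_pos.2 (kleinGap_pos hx)
  have h2 := Real.sqrt_pos.2 (kleinGap_pos hy)
  rw [one_le_div (by positivity)]
  refine abs_le_of_sq_le_sq' ?_ (one_sub_inner_pos hx hy).le |>.2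
  rw [mul_pow, Real.sq_sqrt (kleinGap_pos hx).le, Real.sq_sqrt (kleinGap_pos hy).le]
  nlinarith [kleinSpeed_sub_sq y hx, sq_nonneg (kleinSpeed x (y - x))]

theorem cosh_hypDist (hx : ‖x‖ < 1) (hy : ‖y‖ < 1) :
    Real.cosh (hypDist x y) = (1 - inner ℝ x y) / (√(kleinGap x) * √(kleinGap y)) :=
  Real.cosh_arcosh (one_le_cosh_ratio hx hy)

theorem hypDist_nonneg (hx : ‖x‖ < 1) (hy : ‖y‖ < 1) : 0 ≤ hypDist x y :=
  Real.arcosh_nonneg (one_le_cosh_ratio hx hy)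

theorem sinh_hypDist (hx : ‖x‖ < 1) (hy : ‖y‖ < 1) :
    Real.sinh (hypDist x y) = kleinSpeed x (y - x) / (√(kleinGap x) * √(kleinGap y)) := by
  have h1 := Real.sqrt_pos.2 (kleinGap_pos hx)
  have h2 := Real.sqrt_pos.2 (kleinGap_pos hy)
  have h3 := kleinSpeed_nonneg x (y - x)
  have h4 := Real.sinh_nonneg_iff.2 (hypDist_nonneg hx hy)
  rw [← sq_eq_sq₀ h4 (by positivity), Real.sinh_sq, cosh_hypDist hx hy, div_pow, div_pow,
    kleinSpeed_sub_sq y hx, mul_pow, Real.sq_sqrt (kleinGap_pos hx).le,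
    Real.sq_sqrt (kleinGap_pos hy).le]
  have := kleinGap_pos hx
  have := kleinGap_pos hy
  field_simp

theorem hypDist_eq_arsinh (hx : ‖x‖ < 1) (hy : ‖y‖ < 1) :
    hypDist x y = Real.arsinh (kleinSpeed x (y - x) / (√(kleinGap x) * √(kleinGap y))) := by
  rw [← sinh_hypDist hx hy, Real.arsinh_sinh]

theorem norm_lineMap_lt_one (hs : ‖s‖ < 1) (ht : ‖t‖ < 1) {τ : ℝ} (h0 : 0 ≤ τ) (h1 : τ ≤ 1) :
    ‖s + τ • (t - s)‖ < 1 := by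
  have h := (convex_ball (0 : EuclideanSpace ℝ (Fin n)) 1).add_smul_sub_mem
    (by simpa using hs) (by simpa using ht) ⟨h0, h1⟩
  simpa using h

theorem kleinSpeed_lineMap_left {τ : ℝ} (h0 : 0 ≤ τ) :
    kleinSpeed s (s + τ • (t - s) - s) = τ * kleinSpeed s (t - s) := by
  rw [add_sub_cancel_left, kleinSpeed_smul _ _ h0]

theorem kleinSpeed_lineMap_right {τ : ℝ} (h1 : τ ≤ 1) :
    kleinSpeed (s + τ • (t - s)) (t - (s + τ • (t - s))) = (1 - τ) * kleinSpeed s (t - s) := by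
  have : t - (s + τ • (t - s)) = (1 - τ) • (t - s) := by module
  rw [this, kleinSpeed_smul _ _ (by linarith), kleinSpeed_add_smul]

theorem hypDist_add_of_lineMap (hs : ‖s‖ < 1) (ht : ‖t‖ < 1) {τ : ℝ} (h0 : 0 ≤ τ) (h1 : τ ≤ 1) :
    hypDist s (s + τ • (t - s)) + hypDist (s + τ • (t - s)) t = hypDist s t := by
  have hz := norm_lineMap_lt_one hs ht h0 h1
  apply Real.sinh_injective
  rw [Real.sinh_add, sinh_hypDist hs hz, sinh_hypDist hz ht, cosh_hypDist hs hz,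
    cosh_hypDist hz ht, sinh_hypDist hs ht, kleinSpeed_lineMap_left h0,
    kleinSpeed_lineMap_right h1]
  -- For `z = (1 - τ) s + τ t`, the function `1 - ⟨z, ·⟩` is affine, so its values at `t` and `s`
  -- interpolate to `1 - ⟨z, z⟩`.
  have hkey : τ * (1 - inner ℝ (s + τ • (t - s)) t) + (1 - τ) * (1 - inner ℝ s (s + τ • (t - s)))
      = kleinGap (s + τ • (t - s)) := by
    rw [kleinGap_add_smul]
    simp only [kleinGap, norm_sub_sq_real, inner_add_left, inner_add_right, real_inner_smul_left,
      inner_smul_right, inner_sub_left, inner_sub_right, real_inner_self_eq_norm_sq,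
      real_inner_comm s t]
    ring
  set z := s + τ • (t - s)
  have a := Real.sqrt_pos.2 (kleinGap_pos hs)
  have b := Real.sqrt_pos.2 (kleinGap_pos ht)
  have c := Real.sqrt_pos.2 (kleinGap_pos hz)
  have c2 := Real.sq_sqrt (kleinGap_pos hz).le
  field_simp
  rw [c2, ← hkey]
  ring

/-- Equality in the triangle inequality forces `z` onto the Euclidean segment from `s` to `t`. -/
theorem exists_lineMap_of_hypDist_add (hs : ‖s‖ < 1) (ht : ‖t‖ < 1) (hz : ‖z‖ < 1)
    (h : hypDist s z + hypDist z t = hypDist s t) :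
    ∃ τ : ℝ, 0 ≤ τ ∧ τ ≤ 1 ∧ z = s + τ • (t - s) := by
  have hc := congrArg Real.cosh h
  rw [Real.cosh_add, cosh_hypDist hs hz, cosh_hypDist hz ht, cosh_hypDist hs ht,
    sinh_hypDist hs hz, sinh_hypDist hz ht] at hc
  have a := Real.sqrt_pos.2 (kleinGap_pos hs)
  have b := Real.sqrt_pos.2 (kleinGap_pos ht)
  have c := Real.sqrt_pos.2 (kleinGap_pos hz)
  have c2 := Real.sq_sqrt (kleinGap_pos hz).le
  have hE : kleinSpeed s (z - s) = kleinSpeed z (s - z) := by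
    have := kleinSpeed_add_smul s (z - s) 1
    rw [one_smul, add_sub_cancel] at this
    rw [← this, ← kleinSpeed_neg, neg_sub]
  rw [hE] at hc
  have ha := kleinSpeed_sq (s - z) hz
  have hb := kleinSpeed_sq (t - z) hz
  have hα := kleinSpeed_nonneg z (s - z)
  have hβ := kleinSpeed_nonneg z (t - z)
  set α := kleinSpeed z (s - z) with hαdef
  set β := kleinSpeed z (t - z) with hβdef
  have hmain : (1 - inner ℝ s z) * (1 - inner ℝ z t) + α * β
      = (1 - inner ℝ s t) * kleinGap z := by
    field_simp at hc
    rw [c2] at hc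
    linarith
  -- the Lorentz-orthogonal component of `β s + α t` is null
  have hw : β • (s - z) + α • (t - z) = 0 := by
    have h0 : ‖β • (s - z) + α • (t - z)‖ ^ 2 * kleinGap z
        -- In the metric at `z` (rescaled by the squared gap), `s - z` and `t - z` have norms `α`
        -- and `β` and pairing `-αβ`, so they point in opposite directions and the combination has
        -- norm zero.
        + inner ℝ z (β • (s - z) + α • (t - z)) ^ 2 = 0 := by
      have hin : inner ℝ (s - z) (t - z) * kleinGap z + inner ℝ z (s - z) * inner ℝ z (t - z)
          = - (α * β) := by
        have : inner ℝ (s - z) (t - z) * kleinGap z + inner ℝ z (s - z) * inner ℝ z (t - z)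
          = (1 - inner ℝ s z) * (1 - inner ℝ z t) - (1 - inner ℝ s t) * kleinGap z := by
          simp only [kleinGap, inner_sub_left, inner_sub_right, real_inner_self_eq_norm_sq,
            real_inner_comm s z]
          ring
        linarith
      simp only [norm_add_sq_real, inner_add_right, inner_smul_right, real_inner_smul_left,
        norm_smul, mul_pow, Real.norm_eq_abs, sq_abs]
      linear_combination (-β^2) * ha - α^2 * hb + 2 * α * β * hin
    have hg := kleinGap_pos hz
    have h1 : ‖β • (s - z) + α • (t - z)‖ ^ 2 = 0 := by
      have := sq_nonneg (inner ℝ z (β • (s - z) + α • (t - z)))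
      have := sq_nonneg ‖β • (s - z) + α • (t - z)‖
      by_contra hne
      have : 0 < ‖β • (s - z) + α • (t - z)‖ ^ 2 := by positivity
      nlinarith
    simpa using h1
  rcases eq_or_lt_of_le hα with h0 | h0
  · have hsz : s = z := by
      by_contra hne
      exact absurd h0 (kleinSpeed_pos hz (sub_ne_zero.2 hne)).ne
    exact ⟨0, le_rfl, zero_le_one, by simp [hsz]⟩
  · have hne : α + β ≠ 0 := by positivity
    refine ⟨α / (α + β), by positivity, by rw [div_le_one (by positivity)]; linarith, ?_⟩
    have h2 : (α + β) • z = (α + β) • s + α • (t - s) := by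
      rw [← sub_eq_zero, ← neg_eq_zero, ← hw]; module
    have h3 : z = (α + β)⁻¹ • ((α + β) • z) := by rw [smul_smul, inv_mul_cancel₀ hne, one_smul]
    rw [h3, h2, smul_add, smul_smul, smul_smul, inv_mul_cancel₀ hne, one_smul, div_eq_inv_mul]

theorem mem_geodSegment_iff (hs : ‖s‖ < 1) (ht : ‖t‖ < 1) :
    z ∈ geodSegment s t ↔ ∃ τ ∈ Set.Icc (0 : ℝ) 1, z = s + τ • (t - s) := by
  constructor
  · rintro ⟨hz, h⟩
    obtain ⟨τ, h0, h1, rfl⟩ := exists_lineMap_of_hypDist_add hs ht (mem_hypSpace_iff.1 hz) h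
    exact ⟨τ, ⟨h0, h1⟩, rfl⟩
  · rintro ⟨τ, ⟨h0, h1⟩, rfl⟩
    exact ⟨mem_hypSpace_iff.2 (norm_lineMap_lt_one hs ht h0 h1), hypDist_add_of_lineMap hs ht h0 h1⟩

theorem mem_hypBall_iff {r : ℝ} (hr : 0 ≤ r) :
    x ∈ hypBall n r ↔ 1 ≤ Real.cosh r ^ 2 * kleinGap x := by
  have hc := Real.one_le_cosh r
  constructor
  · rintro ⟨hx, h⟩
    rw [mem_hypSpace_iff] at hx
    have hg := kleinGap_pos hx
    have h1 : Real.cosh (hypDist 0 x) ≤ Real.cosh r := by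
      rw [Real.cosh_le_cosh, abs_of_nonneg (hypDist_nonneg (by simp) hx), abs_of_nonneg hr]
      exact h
    rw [cosh_hypDist (by simp) hx] at h1
    have h0 : kleinGap (0 : EuclideanSpace ℝ (Fin n)) = 1 := by simp [kleinGap]
    rw [h0, inner_zero_left, Real.sqrt_one, sub_zero, one_mul,
      div_le_iff₀ (Real.sqrt_pos.2 hg)] at h1
    calc (1 : ℝ) ≤ (Real.cosh r * √(kleinGap x)) ^ 2 := one_le_pow₀ h1
      _ = _ := by rw [mul_pow, Real.sq_sqrt hg.le]
  · intro h
    have hg : 0 < kleinGap x := by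
      by_contra hneg
      have : Real.cosh r ^ 2 * kleinGap x ≤ 0 :=
        mul_nonpos_of_nonneg_of_nonpos (by positivity) (not_lt.1 hneg)
      linarith
    have hx := kleinGap_pos_iff.1 hg
    refine ⟨mem_hypSpace_iff.2 hx, ?_⟩
    have h0 : kleinGap (0 : EuclideanSpace ℝ (Fin n)) = 1 := by simp [kleinGap]
    have h1 : Real.cosh (hypDist 0 x) ≤ Real.cosh r := by
      rw [cosh_hypDist (by simp) hx, h0, inner_zero_left, Real.sqrt_one, sub_zero, one_mul,
        div_le_iff₀ (Real.sqrt_pos.2 hg)]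
      refine abs_le_of_sq_le_sq' ?_ (by positivity) |>.2
      rw [mul_pow, Real.sq_sqrt hg.le]
      linarith
    rwa [Real.cosh_le_cosh, abs_of_nonneg (hypDist_nonneg (by simp) hx), abs_of_nonneg hr] at h1

theorem hypBall_eq_closedBall {r : ℝ} (hr : 0 ≤ r) :
    hypBall n r = Metric.closedBall 0 (Real.tanh r) := by
  ext x
  rw [mem_hypBall_iff hr, mem_closedBall_zero_iff, kleinGap]
  have hc := Real.cosh_pos r
  have hs := Real.sinh_nonneg_iff.2 hr
  have hsq := Real.cosh_sq r
  rw [Real.tanh_eq_sinh_div_cosh, le_div_iff₀ hc, ← sq_le_sq₀ (by positivity) hs, mul_pow]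
  constructor <;> intro h <;> linarith

end HypDist

/-! ### Length along a segment as an integral -/

section Length

variable {n : ℕ} {s t : EuclideanSpace ℝ (Fin n)}

/-- For `τ ≥ 0` the differentiated function is the distance from `s` to `s + τ v`, so the derivative
is the Riemannian speed of the line. -/
theorem hasDerivAt_arsinh_lineMap {V : Type*} [NormedAddCommGroup V] [InnerProductSpace ℝ V]
    {s v : V} {τ : ℝ} (hs : ‖s‖ < 1) (hz : ‖s + τ • v‖ < 1) :
    HasDerivAt (fun τ : ℝ => Real.arsinh
        (τ * kleinSpeed s v / (√(kleinGap s) * √(kleinGap (s + τ • v)))))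
      (kleinSpeed s v / kleinGap (s + τ • v)) τ := by
  have hgs := kleinGap_pos hs
  have hgz := kleinGap_pos hz
  have a := Real.sqrt_pos.2 hgs
  have c := Real.sqrt_pos.2 hgz
  have a2 := Real.sq_sqrt hgs.le
  have c2 := Real.sq_sqrt hgz.le
  have hgap : HasDerivAt (fun τ : ℝ => kleinGap (s + τ • v))
      (-2 * inner ℝ s v - 2 * τ * ‖v‖ ^ 2) τ := by
    simp only [kleinGap_add_smul]
    have h1 : HasDerivAt (fun τ : ℝ => 2 * τ * inner ℝ s v) (2 * inner ℝ s v) τ := by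
      simpa using ((hasDerivAt_id τ).const_mul 2).mul_const (inner ℝ s v)
    have h2 : HasDerivAt (fun τ : ℝ => τ ^ 2 * ‖v‖ ^ 2) (2 * τ * ‖v‖ ^ 2) τ := by
      simpa using (hasDerivAt_pow 2 τ).mul_const (‖v‖ ^ 2)
    refine ((h1.const_sub (kleinGap s)).sub h2).congr_deriv (by ring)
  have hden := (hgap.sqrt hgz.ne').const_mul (√(kleinGap s))
  have hnum : HasDerivAt (fun τ : ℝ => τ * kleinSpeed s v) (kleinSpeed s v) τ := by
    simpa using (hasDerivAt_id τ).mul_const (kleinSpeed s v)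
  refine ((hnum.div hden (by positivity)).arsinh).congr_deriv ?_
  have hE := kleinSpeed_sq v hs
  -- This is `1 + sinh² = cosh²`; it makes the square root in the derivative of `arsinh` explicit.
  have hroot : 1 + (τ * kleinSpeed s v / (√(kleinGap s) * √(kleinGap (s + τ • v)))) ^ 2
      = ((1 - inner ℝ s (s + τ • v)) / (√(kleinGap s) * √(kleinGap (s + τ • v)))) ^ 2 := by
    rw [div_pow, div_pow, mul_pow, mul_pow, a2, c2, hE]
    field_simp
    rw [kleinGap_add_smul]
    simp only [inner_add_right, inner_smul_right, real_inner_self_eq_norm_sq, kleinGap]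
    ring
  have hpos := one_sub_inner_pos hs hz
  have hne := hpos.ne'
  rw [Pi.div_apply, hroot, Real.sqrt_sq (by positivity)]
  have hin : (1 : ℝ) - inner ℝ s (s + τ • v)
      = kleinGap (s + τ • v) + τ * (inner ℝ s v + τ * ‖v‖ ^ 2) := by
    rw [kleinGap_add_smul]
    simp only [inner_add_right, inner_smul_right, real_inner_self_eq_norm_sq, kleinGap]
    ring
  set g := kleinGap (s + τ • v)
  rw [smul_eq_mul]
  field_simp
  rw [c2, hin]
  ring

/-- For `s ≠ t` the arc length is a strictly increasing function of the affine parameter, so this is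
the one-dimensional change of variables; for `s = t` both sides vanish. -/
theorem lengthInter_eq_lintegral {X : Set (EuclideanSpace ℝ (Fin n))} (hX : MeasurableSet X)
    (hs : ‖s‖ < 1) (ht : ‖t‖ < 1) :
    lengthInter X s t = ∫⁻ τ in Set.Icc (0 : ℝ) 1,
      X.indicator (fun z => ENNReal.ofReal (kleinSpeed z (t - s) / kleinGap z))
        (s + τ • (t - s)) := by
  set v := t - s with hv
  have hball : ∀ τ ∈ Set.Icc (0 : ℝ) 1, ‖s + τ • v‖ < 1 :=
    fun τ hτ => norm_lineMap_lt_one hs ht hτ.1 hτ.2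
  rcases eq_or_ne v 0 with h0 | h0
  · have hts : t = s := sub_eq_zero.1 h0
    have hR : ∀ z : EuclideanSpace ℝ (Fin n),
        X.indicator (fun z => ENNReal.ofReal (kleinSpeed z v / kleinGap z)) z = 0 := by
      intro z
      simp [Set.indicator, h0, kleinSpeed_zero]
    simp only [hR, lintegral_zero]
    refine measure_mono_null ?_ (measure_singleton (hypDist s s))
    rintro _ ⟨z, ⟨-, hz⟩, rfl⟩
    obtain ⟨τ, -, rfl⟩ := (mem_geodSegment_iff hs ht).1 hz
    simp [hts]
  set h : ℝ → ℝ := fun τ => Real.arsinh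
    (τ * kleinSpeed s v / (√(kleinGap s) * √(kleinGap (s + τ • v))))
  have hder : ∀ τ ∈ Set.Icc (0 : ℝ) 1, HasDerivAt h (kleinSpeed s v / kleinGap (s + τ • v)) τ :=
    fun τ hτ => hasDerivAt_arsinh_lineMap hs (hball τ hτ)
  have hpos : ∀ τ ∈ Set.Icc (0 : ℝ) 1, 0 < kleinSpeed s v / kleinGap (s + τ • v) :=
    fun τ hτ => div_pos (kleinSpeed_pos hs h0) (kleinGap_pos (hball τ hτ))
  have hmono : StrictMonoOn h (Set.Icc 0 1) := by
    refine strictMonoOn_of_deriv_pos (convex_Icc 0 1)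
      (fun τ hτ => (hder τ hτ).continuousAt.continuousWithinAt) fun τ hτ => ?_
    have hτ' := interior_subset hτ
    rw [(hder τ hτ').deriv]
    exact hpos τ hτ'
  set γ : ℝ → EuclideanSpace ℝ (Fin n) := fun τ => s + τ • v
  have hγ : Measurable γ := by fun_prop
  have hA : MeasurableSet (Set.Icc (0 : ℝ) 1 ∩ γ ⁻¹' X) := measurableSet_Icc.inter (hγ hX)
  have himg : (fun z => hypDist s z) '' (X ∩ geodSegment s t)
      = h '' (Set.Icc (0 : ℝ) 1 ∩ γ ⁻¹' X) := by
    have hh : ∀ τ ∈ Set.Icc (0 : ℝ) 1, hypDist s (γ τ) = h τ := fun τ hτ => by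
      rw [hypDist_eq_arsinh hs (hball τ hτ), kleinSpeed_lineMap_left hτ.1]
    ext d
    constructor
    · rintro ⟨z, ⟨hzX, hz⟩, rfl⟩
      obtain ⟨τ, hτ, rfl⟩ := (mem_geodSegment_iff hs ht).1 hz
      exact ⟨τ, ⟨hτ, hzX⟩, (hh τ hτ).symm⟩
    · rintro ⟨τ, ⟨hτ, hzX⟩, rfl⟩
      exact ⟨γ τ, ⟨hzX, (mem_geodSegment_iff hs ht).2 ⟨τ, hτ, rfl⟩⟩, hh τ hτ⟩
  have hcov := lintegral_image_eq_lintegral_abs_deriv_mul hA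
    (fun τ hτ => (hder τ hτ.1).hasDerivWithinAt) (hmono.injOn.mono Set.inter_subset_left)
    (fun _ => (1 : ℝ≥0∞))
  rw [lintegral_one, Measure.restrict_apply_univ] at hcov
  rw [lengthInter, himg, hcov, Set.inter_comm, ← Measure.restrict_restrict (hγ hX),
    ← lintegral_indicator (hγ hX)]
  refine setLIntegral_congr_fun measurableSet_Icc fun τ hτ => ?_
  by_cases hx : γ τ ∈ X
  · have hx' : τ ∈ γ ⁻¹' X := hx
    change _ = X.indicator _ (γ τ)
    rw [Set.indicator_of_mem hx', Set.indicator_of_mem hx, mul_one, abs_of_pos (hpos τ hτ),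
      kleinSpeed_add_smul]
  · have hx' : τ ∉ γ ⁻¹' X := hx
    change _ = X.indicator _ (γ τ)
    rw [Set.indicator_of_notMem hx', Set.indicator_of_notMem hx]

end Length

/-! ### The load as the integral of a density -/

noncomputable section Santalo

/-- The change of variables `(s, t) ↦ (s + τ (t - s), t - s)`, which preserves Lebesgue measure. -/
theorem lintegral_pair_eq_lintegral_point_direction {E : Type*} [NormedAddCommGroup E]
    [NormedSpace ℝ E] [FiniteDimensional ℝ E] [MeasurableSpace E] [BorelSpace E]
    (μ : Measure E) [μ.IsAddHaarMeasure] {W : E → ℝ≥0∞} (hW : Measurable W)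
    {G : E × E → ℝ≥0∞} (hG : Measurable G) (ν : Measure ℝ) [SFinite ν] :
    ∫⁻ s, W s * ∫⁻ t, W t * ∫⁻ τ, G (s + τ • (t - s), t - s) ∂ν ∂μ ∂μ
      = ∫⁻ z, ∫⁻ v, ∫⁻ τ, W (z - τ • v) * W (z + (1 - τ) • v) * G (z, v) ∂ν ∂μ ∂μ := by
  calc ∫⁻ s, W s * ∫⁻ t, W t * ∫⁻ τ, G (s + τ • (t - s), t - s) ∂ν ∂μ ∂μ
      = ∫⁻ s, ∫⁻ v, ∫⁻ τ, W s * (W (s + v) * G (s + τ • v, v)) ∂ν ∂μ ∂μ := by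
        refine lintegral_congr fun s => ?_
        rw [← lintegral_add_left_eq_self _ s, ← lintegral_const_mul]
        · refine lintegral_congr fun v => ?_
          simp only [add_sub_cancel_left]
          rw [lintegral_const_mul _ (by fun_prop), lintegral_const_mul _ (by fun_prop)]
        · refine (hW.comp (by fun_prop)).mul (Measurable.lintegral_prod_right ?_)
          fun_prop
    _ = ∫⁻ v, ∫⁻ s, ∫⁻ τ, W s * (W (s + v) * G (s + τ • v, v)) ∂ν ∂μ ∂μ := by
        refine lintegral_lintegral_swap (Measurable.aemeasurable ?_)
        refine Measurable.lintegral_prod_right ?_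
        fun_prop
    _ = ∫⁻ v, ∫⁻ τ, ∫⁻ s, W s * (W (s + v) * G (s + τ • v, v)) ∂μ ∂ν ∂μ := by
        refine lintegral_congr fun v => lintegral_lintegral_swap (Measurable.aemeasurable ?_)
        fun_prop
    _ = ∫⁻ v, ∫⁻ τ, ∫⁻ z, W (z - τ • v) * W (z + (1 - τ) • v) * G (z, v) ∂μ ∂ν ∂μ := by
        refine lintegral_congr fun v => lintegral_congr fun τ => ?_
        rw [← lintegral_sub_right_eq_self _ (τ • v)]
        refine lintegral_congr fun z => ?_
        rw [← mul_assoc, sub_add_cancel,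
          show z - τ • v + v = z + (1 - τ) • v by module]
    _ = ∫⁻ v, ∫⁻ z, ∫⁻ τ, W (z - τ • v) * W (z + (1 - τ) • v) * G (z, v) ∂ν ∂μ ∂μ := by
        refine lintegral_congr fun v => lintegral_lintegral_swap (Measurable.aemeasurable ?_)
        fun_prop
    _ = _ := by
        refine lintegral_lintegral_swap (Measurable.aemeasurable ?_)
        refine Measurable.lintegral_prod_right ?_
        fun_prop

variable {n : ℕ} {R : ℝ}

/-- The density of `hypVolume` with respect to Lebesgue measure on the Klein ball. -/
def hypWeight (n : ℕ) (x : EuclideanSpace ℝ (Fin n)) : ℝ≥0∞ :=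
  ENNReal.ofReal (kleinGap x ^ (-((n : ℝ) + 1) / 2))

/-- The density of hyperbolic volume restricted to `B_R(0)`. -/
def ballWeight (n : ℕ) (R : ℝ) : EuclideanSpace ℝ (Fin n) → ℝ≥0∞ :=
  (hypBall n R).indicator (hypWeight n)

@[fun_prop]
theorem measurable_kleinGap : Measurable (kleinGap : EuclideanSpace ℝ (Fin n) → ℝ) := by
  unfold kleinGap; fun_prop

@[fun_prop]
theorem measurable_kleinSpeed {α : Type*} [MeasurableSpace α] {f g : α → EuclideanSpace ℝ (Fin n)}
    (hf : Measurable f) (hg : Measurable g) : Measurable fun a => kleinSpeed (f a) (g a) := by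
  unfold kleinSpeed kleinGap; fun_prop

@[fun_prop]
theorem measurable_hypWeight : Measurable (hypWeight n) := by
  unfold hypWeight; fun_prop

theorem measurableSet_hypSpace : MeasurableSet (hypSpace n) := measurableSet_ball

theorem measurableSet_hypBall (hR : 0 ≤ R) : MeasurableSet (hypBall n R) := by
  rw [hypBall_eq_closedBall hR]; exact measurableSet_closedBall

theorem measurable_ballWeight (hR : 0 ≤ R) : Measurable (ballWeight n R) :=
  measurable_hypWeight.indicator (measurableSet_hypBall hR)

theorem hypBall_subset_hypSpace : hypBall n R ⊆ hypSpace n := fun _ hx => hx.1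

theorem hypVolume_eq : hypVolume n = (volume.restrict (hypSpace n)).withDensity (hypWeight n) := rfl

instance : SFinite (hypVolume n) := by unfold hypVolume; infer_instance

theorem hypVolume_restrict {A : Set (EuclideanSpace ℝ (Fin n))} (hA : MeasurableSet A)
    (h : A ⊆ hypSpace n) :
    (hypVolume n).restrict A = (volume.restrict A).withDensity (hypWeight n) := by
  rw [hypVolume_eq, restrict_withDensity hA, Measure.restrict_restrict hA,
    Set.inter_eq_self_of_subset_left h]

theorem hypVolume_restrict_hypBall (hR : 0 ≤ R) :
    (hypVolume n).restrict (hypBall n R) = volume.withDensity (ballWeight n R) := by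
  rw [hypVolume_restrict (measurableSet_hypBall hR) hypBall_subset_hypSpace, ballWeight,
    withDensity_indicator (measurableSet_hypBall hR)]

/-- The density of the traffic load with respect to Lebesgue measure. -/
def loadDensity (n : ℕ) (R : ℝ) (z : EuclideanSpace ℝ (Fin n)) : ℝ≥0∞ :=
  ∫⁻ v, ∫⁻ τ in Set.Icc (0 : ℝ) 1, ballWeight n R (z - τ • v) * ballWeight n R (z + (1 - τ) • v) *
    ENNReal.ofReal (kleinSpeed z v / kleinGap z)

theorem measurable_loadDensity (hR : 0 ≤ R) : Measurable (loadDensity n R) := by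
  have hW := measurable_ballWeight (n := n) hR
  refine Measurable.lintegral_prod_right (Measurable.lintegral_prod_right ?_)
  refine ((hW.comp (by fun_prop)).mul (hW.comp (by fun_prop))).mul ?_
  fun_prop

theorem trafficLoad_eq_lintegral_loadDensity (hR : 0 ≤ R) {X : Set (EuclideanSpace ℝ (Fin n))}
    (hX : MeasurableSet X) :
    trafficLoad n R X = ∫⁻ z in X, loadDensity n R z := by
  have hW := measurable_ballWeight (n := n) hR
  have hB := measurableSet_hypBall (n := n) hR
  set G : EuclideanSpace ℝ (Fin n) × EuclideanSpace ℝ (Fin n) → ℝ≥0∞ := (Prod.fst ⁻¹' X).indicator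
    fun p => ENNReal.ofReal (kleinSpeed p.1 p.2 / kleinGap p.1)
  have hG : Measurable G := Measurable.indicator (by fun_prop) (measurable_fst hX)
  have hGX : ∀ z v, X.indicator (fun z => ENNReal.ofReal (kleinSpeed z v / kleinGap z)) z
      = G (z, v) := fun z v => by by_cases hz : z ∈ X <;> simp [G, hz]
  have hinner : Measurable fun p : EuclideanSpace ℝ (Fin n) × EuclideanSpace ℝ (Fin n) =>
      ∫⁻ τ in Set.Icc (0 : ℝ) 1, G (p.1 + τ • (p.2 - p.1), p.2 - p.1) :=
    Measurable.lintegral_prod_right (by fun_prop)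
  clear_value G
  calc trafficLoad n R X
      = ∫⁻ p in hypBall n R ×ˢ hypBall n R, (∫⁻ τ in Set.Icc (0 : ℝ) 1,
          G (p.1 + τ • (p.2 - p.1), p.2 - p.1)) ∂((hypVolume n).prod (hypVolume n)) :=
        setLIntegral_congr_fun (hB.prod hB) fun p hp => by
          simp only [lengthInter_eq_lintegral hX (mem_hypSpace_iff.1 hp.1.1)
            (mem_hypSpace_iff.1 hp.2.1), hGX]
    _ = ∫⁻ s, ballWeight n R s * ∫⁻ t, ballWeight n R t * ∫⁻ τ in Set.Icc (0 : ℝ) 1,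
          G (s + τ • (t - s), t - s) := by
        rw [← Measure.prod_restrict, hypVolume_restrict_hypBall hR, lintegral_prod _
          hinner.aemeasurable, lintegral_withDensity_eq_lintegral_mul _ hW
          hinner.lintegral_prod_right']
        refine lintegral_congr fun s => ?_
        exact congrArg (ballWeight n R s * ·) (lintegral_withDensity_eq_lintegral_mul volume hW
          (hinner.comp (measurable_prodMk_left (x := s))))
    _ = ∫⁻ z, ∫⁻ v, ∫⁻ τ in Set.Icc (0 : ℝ) 1,
          ballWeight n R (z - τ • v) * ballWeight n R (z + (1 - τ) • v) * G (z, v) :=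
        lintegral_pair_eq_lintegral_point_direction volume hW hG _
    _ = _ := by
        rw [← lintegral_indicator hX]
        refine lintegral_congr fun z => ?_
        simp only [← hGX]
        by_cases hz : z ∈ X <;> simp [hz, loadDensity]

/-- The density of the traffic load with respect to hyperbolic volume. -/
def hypLoadDensity (n : ℕ) (R : ℝ) (z : EuclideanSpace ℝ (Fin n)) : ℝ≥0∞ :=
  loadDensity n R z * ENNReal.ofReal (kleinGap z ^ (((n : ℝ) + 1) / 2))

theorem trafficLoad_eq_lintegral_hypLoadDensity (hR : 0 ≤ R) {X : Set (EuclideanSpace ℝ (Fin n))}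
    (hX : MeasurableSet X) (hXs : X ⊆ hypSpace n) :
    trafficLoad n R X = ∫⁻ z in X, hypLoadDensity n R z ∂(hypVolume n) := by
  have hm : Measurable (hypLoadDensity n R) :=
    (measurable_loadDensity hR).mul (by fun_prop)
  rw [trafficLoad_eq_lintegral_loadDensity hR hX, hypVolume_restrict hX hXs,
    lintegral_withDensity_eq_lintegral_mul _ measurable_hypWeight hm]
  refine setLIntegral_congr_fun hX fun z hz => ?_
  have hg := kleinGap_pos (mem_hypSpace_iff.1 (hXs hz))
  rw [Pi.mul_apply, hypWeight, hypLoadDensity, mul_left_comm, ← ENNReal.ofReal_mul (by positivity),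
    ← Real.rpow_add hg, neg_div, neg_add_cancel, Real.rpow_zero, ENNReal.ofReal_one, mul_one]

end Santalo

/-! ### Changes of variables on rays and polar coordinates -/

noncomputable section ChangeOfVariables

theorem lintegral_Ioi_Ioo_eq_lintegral_Ioi_Ioi {F : ℝ × ℝ → ℝ≥0∞} (hF : Measurable F) :
    ∫⁻ r in Set.Ioi (0 : ℝ), ∫⁻ a in Set.Ioo 0 r, F (a, r - a)
      = ∫⁻ a in Set.Ioi (0 : ℝ), ∫⁻ b in Set.Ioi (0 : ℝ), F (a, b) := by
  set G : ℝ × ℝ → ℝ≥0∞ := (Set.Ioi (0 : ℝ) ×ˢ Set.Ioi (0 : ℝ)).indicator F with hG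
  have hGm : Measurable G := hF.indicator (measurableSet_Ioi.prod measurableSet_Ioi)
  calc ∫⁻ r in Set.Ioi (0 : ℝ), ∫⁻ a in Set.Ioo 0 r, F (a, r - a)
      = ∫⁻ r, ∫⁻ a, G (a, r - a) := by
        rw [← lintegral_indicator measurableSet_Ioi]
        refine lintegral_congr fun r => ?_
        by_cases hr : 0 < r
        · rw [Set.indicator_of_mem (Set.mem_Ioi.2 hr), ← lintegral_indicator measurableSet_Ioo]
          refine lintegral_congr fun a => ?_
          simp only [Set.indicator, hG, Set.mem_Ioo, Set.mem_prod, Set.mem_Ioi, sub_pos]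
        · rw [Set.indicator_of_notMem (by simpa using hr)]
          rw [eq_comm, ← lintegral_zero]
          refine lintegral_congr fun a => ?_
          refine Set.indicator_of_notMem ?_ _
          simp only [Set.mem_prod, Set.mem_Ioi]
          rintro ⟨h1, h2⟩
          linarith
    _ = ∫⁻ a, ∫⁻ r, G (a, r - a) :=
        lintegral_lintegral_swap (Measurable.aemeasurable (by fun_prop))
    _ = ∫⁻ a, ∫⁻ b, G (a, b) := by
        refine lintegral_congr fun a => ?_
        exact lintegral_sub_right_eq_self (fun b => G (a, b)) a
    _ = _ := by
        rw [← lintegral_indicator measurableSet_Ioi]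
        refine lintegral_congr fun a => ?_
        by_cases ha : 0 < a
        · rw [Set.indicator_of_mem (Set.mem_Ioi.2 ha), ← lintegral_indicator measurableSet_Ioi]
          refine lintegral_congr fun b => ?_
          simp [Set.indicator, hG, ha]
        · rw [Set.indicator_of_notMem (by simpa using ha)]
          simp [hG, ha]

theorem lintegral_Icc_rescale {r : ℝ} (hr : 0 < r) (F : ℝ → ℝ → ℝ≥0∞) :
    ∫⁻ τ in Set.Icc (0 : ℝ) 1, F (τ * r) ((1 - τ) * r) * ENNReal.ofReal r
      = ∫⁻ a in Set.Ioo 0 r, F a (r - a) := by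
  have himg : (fun τ : ℝ => τ * r) '' Set.Ioo 0 1 = Set.Ioo 0 r := by
    ext a
    constructor
    · rintro ⟨τ, ⟨h0, h1⟩, rfl⟩
      exact ⟨mul_pos h0 hr, mul_lt_of_lt_one_left hr h1⟩
    · rintro ⟨h0, h1⟩
      exact ⟨a / r, ⟨div_pos h0 hr, (div_lt_one hr).2 h1⟩, div_mul_cancel₀ a hr.ne'⟩
  have h := lintegral_image_eq_lintegral_abs_deriv_mul (f := fun τ : ℝ => τ * r)
    (f' := fun _ => r) (s := Set.Ioo (0 : ℝ) 1) measurableSet_Ioo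
    (fun τ _ => by simpa using ((hasDerivAt_id τ).mul_const r).hasDerivWithinAt)
    (fun a _ b _ hab => mul_right_cancel₀ hr.ne' hab) (fun a => F a (r - a))
  rw [himg] at h
  rw [h, Measure.restrict_congr_set Ioo_ae_eq_Icc.symm]
  refine lintegral_congr fun τ => ?_
  rw [abs_of_pos hr, mul_comm, sub_mul, one_mul]

theorem cosh_add_mul_sinh_pos {k : ℝ} (hk : |k| < 1) (h : ℝ) :
    0 < Real.cosh h + k * Real.sinh h := by
  have h1 : |Real.sinh h| < Real.cosh h := abs_lt_of_sq_lt_sq (by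
    rw [Real.cosh_sq]; linarith) (Real.cosh_pos h).le
  have h2 : |k * Real.sinh h| ≤ |Real.sinh h| := by
    rw [abs_mul]; exact mul_le_of_le_one_left (abs_nonneg _) hk.le
  have := neg_abs_le (k * Real.sinh h)
  linarith

/-- The substitution `σ = sinh h / (cosh h + k sinh h)`, relating the Euclidean and the hyperbolic
arc length along a ray. -/
theorem lintegral_Ioi_sinh_div {k : ℝ} (hk : |k| < 1) {f : ℝ → ℝ≥0∞}
    (hf : ∀ σ, 0 < σ → 1 ≤ (1 + k) * σ → f σ = 0) :
    ∫⁻ σ in Set.Ioi (0 : ℝ), f σ = ∫⁻ h in Set.Ioi (0 : ℝ),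
      ENNReal.ofReal (((Real.cosh h + k * Real.sinh h) ^ 2)⁻¹) *
        f (Real.sinh h / (Real.cosh h + k * Real.sinh h)) := by
  obtain ⟨hk1, hk2⟩ := abs_lt.1 hk
  have hD := cosh_add_mul_sinh_pos hk
  set S : ℝ → ℝ := fun h => Real.sinh h / (Real.cosh h + k * Real.sinh h) with hS
  have hder : ∀ h, HasDerivAt S (((Real.cosh h + k * Real.sinh h) ^ 2)⁻¹) h := fun h => by
    refine ((Real.hasDerivAt_sinh h).div ((Real.hasDerivAt_cosh h).add
      ((Real.hasDerivAt_sinh h).const_mul k)) (hD h).ne').congr_deriv ?_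
    rw [inv_eq_one_div]
    congr 1
    have := Real.cosh_sq h
    simp only [Pi.add_apply]
    linear_combination this
  have hinj : Set.InjOn S (Set.Ioi 0) := by
    refine (strictMono_of_deriv_pos fun h => ?_).injective.injOn
    rw [(hder h).deriv]
    exact inv_pos.2 (pow_pos (hD h) 2)
  -- The substitution inverts to `tanh h = σ / (1 - k σ)`, which is below `1` exactly until the ray
  -- leaves the Klein ball; `hf` disposes of the rest.
  have himg : S '' Set.Ioi 0 = Set.Ioi 0 ∩ {σ | (1 + k) * σ < 1} := by
    ext σ
    constructor
    · rintro ⟨h, hh, rfl⟩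
      have hs := Real.sinh_pos_iff.2 hh
      refine ⟨div_pos hs (hD h), ?_⟩
      change (1 + k) * (Real.sinh h / (Real.cosh h + k * Real.sinh h)) < 1
      rw [mul_div_assoc', div_lt_one (hD h)]
      nlinarith [Real.sinh_lt_cosh h]
    · rintro ⟨h0, h1⟩
      rw [Set.mem_Ioi] at h0
      have h1' : (1 + k) * σ < 1 := h1
      have hpos : 0 < 1 - k * σ := by nlinarith
      have hu0 : 0 < σ / (1 - k * σ) := div_pos h0 hpos
      have hu1 : σ / (1 - k * σ) < 1 := by rw [div_lt_one hpos]; linarith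
      refine ⟨Real.artanh (σ / (1 - k * σ)), Real.artanh_pos ⟨hu0, hu1⟩, ?_⟩
      have ht := Real.tanh_artanh (x := σ / (1 - k * σ)) ⟨by linarith, hu1⟩
      rw [Real.tanh_eq_sinh_div_cosh] at ht
      have hc := Real.cosh_pos (Real.artanh (σ / (1 - k * σ)))
      have hd := hD (Real.artanh (σ / (1 - k * σ)))
      rw [div_eq_div_iff hc.ne' hpos.ne'] at ht
      change Real.sinh _ / _ = σ
      rw [div_eq_iff hd.ne']
      linarith
  have h := lintegral_image_eq_lintegral_abs_deriv_mul measurableSet_Ioi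
    (fun h _ => (hder h).hasDerivWithinAt) hinj f
  have hmeas : MeasurableSet {σ : ℝ | (1 + k) * σ < 1} :=
    measurableSet_lt (by fun_prop) (by fun_prop)
  rw [himg, Set.inter_comm, ← Measure.restrict_restrict hmeas, ← lintegral_indicator hmeas] at h
  have hpos : ∀ h, |((Real.cosh h + k * Real.sinh h) ^ 2)⁻¹|
      = ((Real.cosh h + k * Real.sinh h) ^ 2)⁻¹ := fun h => abs_of_nonneg (by positivity)
  simp only [hpos] at h
  rw [← h]
  refine setLIntegral_congr_fun measurableSet_Ioi fun σ hσ => ?_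
  by_cases h1 : (1 + k) * σ < 1
  · exact (Set.indicator_of_mem (s := {σ : ℝ | (1 + k) * σ < 1}) h1 f).symm
  · rw [Set.indicator_of_notMem (s := {σ : ℝ | (1 + k) * σ < 1}) h1, hf σ hσ (not_lt.1 h1)]

theorem lintegral_eq_lintegral_sphere_Ioi {E : Type*} [NormedAddCommGroup E] [NormedSpace ℝ E]
    [Nontrivial E] [FiniteDimensional ℝ E] [MeasurableSpace E] [BorelSpace E] (μ : Measure E)
    [μ.IsAddHaarMeasure] {f : E → ℝ≥0∞} (hf : Measurable f) :
    ∫⁻ x, f x ∂μ = ∫⁻ u : Metric.sphere (0 : E) 1, (∫⁻ r in Set.Ioi (0 : ℝ),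
      ENNReal.ofReal (r ^ (Module.finrank ℝ E - 1)) * f (r • (u : E))) ∂μ.toSphere := by
  have hpres := μ.measurePreserving_homeomorphUnitSphereProd
  have hm : Measurable fun p : Metric.sphere (0 : E) 1 × Set.Ioi (0 : ℝ) =>
      f ((p.2 : ℝ) • (p.1 : E)) := by fun_prop
  calc ∫⁻ x, f x ∂μ = ∫⁻ x : ({(0)}ᶜ : Set E), f x.1 ∂(μ.comap (↑)) := by
        rw [lintegral_subtype_comap (measurableSet_singleton _).compl, restrict_compl_singleton]
    _ = ∫⁻ p, f ((p.2 : ℝ) • (p.1 : E))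
          ∂μ.toSphere.prod (.volumeIoiPow (Module.finrank ℝ E - 1)) := by
        rw [← hpres.lintegral_comp hm]
        refine lintegral_congr fun x => ?_
        have hx : ‖(x : E)‖ ≠ 0 := norm_ne_zero_iff.2 x.2
        simp [smul_smul, hx]
    _ = _ := by
        rw [lintegral_prod _ hm.aemeasurable]
        refine lintegral_congr fun u => ?_
        rw [← lintegral_subtype_comap measurableSet_Ioi]
        exact lintegral_withDensity_eq_lintegral_mul _
          (f := fun r : Set.Ioi (0 : ℝ) => ENNReal.ofReal ((r : ℝ) ^ (Module.finrank ℝ E - 1)))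
          (by fun_prop) (hm.comp (measurable_prodMk_left (x := u)))

end ChangeOfVariables

/-! ### Integration over the chords through a point in one direction -/

noncomputable section RayIntegral

variable {n : ℕ} {R : ℝ}

theorem measurableSet_le_and_le {α : Type*} [MeasurableSpace α] {f g : α → ℝ} {T : ℝ}
    (hf : Measurable f) (hg : Measurable g) : MeasurableSet {x | f x ≤ T ∧ g x ≤ T} :=
  (measurableSet_le hf measurable_const).inter (measurableSet_le hg measurable_const)

theorem ballWeight_eq_zero_of_gap_nonpos {x : EuclideanSpace ℝ (Fin n)}
    (hx : kleinGap x ≤ 0) : ballWeight n R x = 0 := by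
  refine Set.indicator_of_notMem (fun h => ?_) _
  exact hx.not_gt (kleinGap_pos (mem_hypSpace_iff.1 h.1))

theorem ballWeight_ray_eq_zero {z ξ : EuclideanSpace ℝ (Fin n)} {g k : ℝ} (hg : 0 < g)
    (hk : |k| < 1) (hgap : ∀ σ, kleinGap (z + σ • ξ) = g * ((1 - k * σ) ^ 2 - σ ^ 2)) {σ : ℝ}
    (h0 : 0 < σ) (h1 : 1 ≤ (1 + k) * σ) : ballWeight n R (z + σ • ξ) = 0 := by
  obtain ⟨hk1, hk2⟩ := abs_lt.1 hk
  refine ballWeight_eq_zero_of_gap_nonpos ?_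
  rw [hgap]
  refine mul_nonpos_of_nonneg_of_nonpos hg.le ?_
  have h2 : 0 < 1 - k * σ + σ := by nlinarith
  have h3 : 1 - k * σ - σ ≤ 0 := by linarith
  nlinarith

/-- With `D = cosh h + k sinh h` and `σ = sinh h / D`, one has `1 - k σ = cosh h / D`, so the gap
becomes `g / D²`. Equivalently the distance from the origin has hyperbolic cosine `D / √g`, the
hyperbolic law of cosines. -/
theorem ballWeight_ray (hR : 0 ≤ R) {z ξ : EuclideanSpace ℝ (Fin n)} {g k : ℝ} (hg : 0 < g)
    (hk : |k| < 1) (hgap : ∀ σ, kleinGap (z + σ • ξ) = g * ((1 - k * σ) ^ 2 - σ ^ 2)) (h : ℝ) :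
    ballWeight n R (z + (Real.sinh h / (Real.cosh h + k * Real.sinh h)) • ξ)
      = if Real.cosh h + k * Real.sinh h ≤ √g * Real.cosh R then
        ENNReal.ofReal (g ^ (-((n : ℝ) + 1) / 2) * (Real.cosh h + k * Real.sinh h) ^ (n + 1))
        else 0 := by
  have hD := cosh_add_mul_sinh_pos hk h
  have hgap' : kleinGap (z + (Real.sinh h / (Real.cosh h + k * Real.sinh h)) • ξ)
      = g * ((Real.cosh h + k * Real.sinh h) ^ 2)⁻¹ := by
    rw [hgap]
    congr 1
    field_simp
    linear_combination Real.cosh_sq h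
  have hmem : z + (Real.sinh h / (Real.cosh h + k * Real.sinh h)) • ξ ∈ hypBall n R ↔
      Real.cosh h + k * Real.sinh h ≤ √g * Real.cosh R := by
    rw [mem_hypBall_iff hR, hgap', ← sq_le_sq₀ hD.le (by positivity), mul_pow, Real.sq_sqrt hg.le,
      ← mul_assoc, ← div_eq_mul_inv, one_le_div (by positivity), mul_comm g]
  by_cases hle : Real.cosh h + k * Real.sinh h ≤ √g * Real.cosh R
  · rw [if_pos hle, ballWeight, Set.indicator_of_mem (hmem.2 hle), hypWeight, hgap',
      Real.mul_rpow hg.le (by positivity), Real.inv_rpow (by positivity), ← Real.rpow_natCast_mul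
      hD.le, ← Real.rpow_neg hD.le, ← Real.rpow_natCast]
    congr 3
    push_cast
    ring
  · rw [if_neg hle, ballWeight, Set.indicator_of_notMem (mt hmem.1 hle)]

/-- The integrand of the load density over all chords through a point in a fixed direction, in
terms of hyperbolic arc length: `q` is the length of the chord `[s, t]` and `a` the distance from
`s` to the point. -/
theorem lintegral_ray {m : ℕ} (hR : 0 ≤ R) {z ξ : EuclideanSpace ℝ (Fin (m + 1))} {g k : ℝ}
    (hg : 0 < g) (hk : |k| < 1) (hz : kleinGap z = g) (hξ : kleinSpeed z ξ = g)
    (hgap : ∀ σ, kleinGap (z + σ • ξ) = g * ((1 - k * σ) ^ 2 - σ ^ 2)) :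
    ∫⁻ r in Set.Ioi (0 : ℝ), ENNReal.ofReal (r ^ m) * ∫⁻ τ in Set.Icc (0 : ℝ) 1,
        ballWeight (m + 1) R (z - τ • (r • ξ)) * ballWeight (m + 1) R (z + (1 - τ) • (r • ξ)) *
          ENNReal.ofReal (kleinSpeed z (r • ξ) / kleinGap z)
      = ENNReal.ofReal (g ^ (-(((m + 1 : ℕ) : ℝ) + 1) / 2)) ^ 2 *
        ∫⁻ q in Set.Ioi (0 : ℝ), ENNReal.ofReal (Real.sinh q ^ m) *
          volume {a ∈ Set.Ioo 0 q | Real.cosh a - k * Real.sinh a ≤ √g * Real.cosh R ∧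
            Real.cosh (q - a) + k * Real.sinh (q - a) ≤ √g * Real.cosh R} := by
  have hW := measurable_ballWeight (n := m + 1) hR
  have hk' : |-k| < 1 := by rwa [abs_neg]
  have hgap' : ∀ σ, kleinGap (z + σ • (-ξ)) = g * ((1 - (-k) * σ) ^ 2 - σ ^ 2) := fun σ => by
    rw [smul_neg, ← neg_smul, hgap]; ring
  set T := √g * Real.cosh R with hT
  set P : ℝ → ℝ≥0∞ := fun b => ballWeight (m + 1) R (z + b • ξ) with hP
  set M : ℝ → ℝ≥0∞ := fun a => ballWeight (m + 1) R (z + a • (-ξ)) with hM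
  have hPm : Measurable P := hW.comp (by fun_prop)
  have hMm : Measurable M := hW.comp (by fun_prop)
  set F : ℝ × ℝ → ℝ≥0∞ := fun x => ENNReal.ofReal ((x.1 + x.2) ^ m) * (M x.1 * P x.2) with hF
  have hFm : Measurable F := by fun_prop
  set H : ℝ × ℝ → ℝ≥0∞ := ({x : ℝ × ℝ | Real.cosh x.1 - k * Real.sinh x.1 ≤ T ∧
      Real.cosh x.2 + k * Real.sinh x.2 ≤ T}).indicator
    (fun x => ENNReal.ofReal (Real.sinh (x.1 + x.2) ^ m)) with hH
  have hHset : MeasurableSet {x : ℝ × ℝ | Real.cosh x.1 - k * Real.sinh x.1 ≤ T ∧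
      Real.cosh x.2 + k * Real.sinh x.2 ≤ T} :=
    measurableSet_le_and_le (by fun_prop) (by fun_prop)
  have hHm : Measurable H := Measurable.indicator (by fun_prop) hHset
  set c := g ^ (-(((m + 1 : ℕ) : ℝ) + 1) / 2) with hc
  have hc0 : 0 < c := by positivity
  -- Writing `A`, `B` for the two denominators, the sum of the Euclidean parameters is `sinh (a + b)
  -- / (A B)`. Its `m`-th power and the Jacobians `A⁻²`, `B⁻²` contribute `(A B)^(-(m + 2))`, which
  -- cancels the powers in the two volume densities.
  have hpt : ∀ a b : ℝ, 0 < a → 0 < b →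
      ENNReal.ofReal (((Real.cosh a + -k * Real.sinh a) ^ 2)⁻¹) *
      (ENNReal.ofReal (((Real.cosh b + k * Real.sinh b) ^ 2)⁻¹) *
        F (Real.sinh a / (Real.cosh a + -k * Real.sinh a),
          Real.sinh b / (Real.cosh b + k * Real.sinh b)))
      = ENNReal.ofReal c ^ 2 * H (a, b) := by
    intro a b ha hb
    have hDa := cosh_add_mul_sinh_pos hk' a
    have hDb := cosh_add_mul_sinh_pos hk b
    have h1 := ballWeight_ray hR hg hk' hgap' a
    have h2 := ballWeight_ray hR hg hk hgap b
    simp only [hF, hM, hP]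
    rw [h1, h2]
    have hneg : Real.cosh a - k * Real.sinh a = Real.cosh a + -k * Real.sinh a := by ring
    by_cases h3 : Real.cosh a + -k * Real.sinh a ≤ T
    · by_cases h4 : Real.cosh b + k * Real.sinh b ≤ T
      · have hmem : ((a, b) : ℝ × ℝ) ∈ {x : ℝ × ℝ | Real.cosh x.1 - k * Real.sinh x.1 ≤ T ∧
            Real.cosh x.2 + k * Real.sinh x.2 ≤ T} := ⟨by simpa only [hneg] using h3, h4⟩
        rw [if_pos h3, if_pos h4, hH, Set.indicator_of_mem hmem, ← ENNReal.ofReal_pow hc0.le,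
          ← ENNReal.ofReal_mul (by positivity), ← ENNReal.ofReal_mul (by
            have := Real.sinh_pos_iff.2 ha
            have := Real.sinh_pos_iff.2 hb
            positivity), ← ENNReal.ofReal_mul (by positivity),
          ← ENNReal.ofReal_mul (by positivity), ← ENNReal.ofReal_mul (by positivity)]
        congr 1
        have hsum : Real.sinh a / (Real.cosh a + -k * Real.sinh a)
            + Real.sinh b / (Real.cosh b + k * Real.sinh b) = Real.sinh (a + b) /
              ((Real.cosh a + -k * Real.sinh a) * (Real.cosh b + k * Real.sinh b)) := by
          rw [div_add_div _ _ hDa.ne' hDb.ne', Real.sinh_add]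
          congr 1
          ring
        rw [hsum, div_pow, mul_pow]
        generalize Real.cosh a + -k * Real.sinh a = A at *
        generalize Real.cosh b + k * Real.sinh b = B at *
        rw [← hc]
        clear_value c
        field_simp
        ring
      · have hmem : ((a, b) : ℝ × ℝ) ∉ {x : ℝ × ℝ | Real.cosh x.1 - k * Real.sinh x.1 ≤ T ∧
            Real.cosh x.2 + k * Real.sinh x.2 ≤ T} := fun h => h4 h.2
        rw [if_neg h4, hH, Set.indicator_of_notMem hmem]
        simp
    · have hmem : ((a, b) : ℝ × ℝ) ∉ {x : ℝ × ℝ | Real.cosh x.1 - k * Real.sinh x.1 ≤ T ∧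
          Real.cosh x.2 + k * Real.sinh x.2 ≤ T} := fun h => h3 (by rw [← hneg]; exact h.1)
      rw [if_neg h3, hH, Set.indicator_of_notMem hmem]
      simp
  calc ∫⁻ r in Set.Ioi (0 : ℝ), ENNReal.ofReal (r ^ m) * ∫⁻ τ in Set.Icc (0 : ℝ) 1,
        ballWeight (m + 1) R (z - τ • (r • ξ)) * ballWeight (m + 1) R (z + (1 - τ) • (r • ξ)) *
          ENNReal.ofReal (kleinSpeed z (r • ξ) / kleinGap z)
      = ∫⁻ r in Set.Ioi (0 : ℝ), ∫⁻ a in Set.Ioo 0 r, F (a, r - a) := by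
        refine setLIntegral_congr_fun measurableSet_Ioi fun r hr => ?_
        have hr' : 0 < r := hr
        -- The hyperbolic norm of `r • ξ` is `r`, which is exactly the Jacobian of `a = τ r`.
        have h1 := lintegral_Icc_rescale hr' fun a b => M a * P b
        have h2 : ∀ τ : ℝ, ballWeight (m + 1) R (z - τ • (r • ξ)) *
            ballWeight (m + 1) R (z + (1 - τ) • (r • ξ)) *
              ENNReal.ofReal (kleinSpeed z (r • ξ) / kleinGap z)
            = M (τ * r) * P ((1 - τ) * r) * ENNReal.ofReal r := fun τ => by
          simp only [hM, hP]
          rw [smul_smul, smul_smul, smul_neg, ← sub_eq_add_neg, kleinSpeed_smul _ _ hr'.le, hξ, hz,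
            mul_div_cancel_right₀ _ hg.ne']
        simp only [h2, h1]
        rw [← lintegral_const_mul _ (by fun_prop)]
        simp only [hF, add_sub_cancel]
    _ = ∫⁻ a in Set.Ioi (0 : ℝ), ∫⁻ b in Set.Ioi (0 : ℝ), F (a, b) :=
        lintegral_Ioi_Ioo_eq_lintegral_Ioi_Ioi hFm
    _ = ∫⁻ a in Set.Ioi (0 : ℝ), ENNReal.ofReal (((Real.cosh a + -k * Real.sinh a) ^ 2)⁻¹) *
          ∫⁻ b in Set.Ioi (0 : ℝ), ENNReal.ofReal (((Real.cosh b + k * Real.sinh b) ^ 2)⁻¹) *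
            F (Real.sinh a / (Real.cosh a + -k * Real.sinh a),
              Real.sinh b / (Real.cosh b + k * Real.sinh b)) := by
        rw [lintegral_Ioi_sinh_div hk']
        · refine lintegral_congr fun a => ?_
          rw [lintegral_Ioi_sinh_div hk]
          intro σ h0 h1
          simp only [hF, hP, ballWeight_ray_eq_zero hg hk hgap h0 h1, mul_zero]
        · intro σ h0 h1
          simp only [hF, hM, ballWeight_ray_eq_zero hg hk' hgap' h0 h1, zero_mul, mul_zero,
            lintegral_zero]
    _ = ∫⁻ a in Set.Ioi (0 : ℝ), ∫⁻ b in Set.Ioi (0 : ℝ), ENNReal.ofReal c ^ 2 * H (a, b) := by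
        refine setLIntegral_congr_fun measurableSet_Ioi fun a ha => ?_
        rw [← lintegral_const_mul _ (by fun_prop)]
        exact setLIntegral_congr_fun measurableSet_Ioi fun b hb => hpt a b ha hb
    _ = ENNReal.ofReal c ^ 2 * ∫⁻ a in Set.Ioi (0 : ℝ), ∫⁻ b in Set.Ioi (0 : ℝ), H (a, b) := by
        rw [← lintegral_const_mul _ (Measurable.lintegral_prod_right (by fun_prop))]
        exact lintegral_congr fun a => lintegral_const_mul _ (by fun_prop)
    _ = ENNReal.ofReal c ^ 2 * ∫⁻ q in Set.Ioi (0 : ℝ), ∫⁻ a in Set.Ioo 0 q, H (a, q - a) := by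
        rw [lintegral_Ioi_Ioo_eq_lintegral_Ioi_Ioi hHm]
    _ = _ := by
        congr 1
        refine lintegral_congr fun q => ?_
        have hset : MeasurableSet {a : ℝ | Real.cosh a - k * Real.sinh a ≤ T ∧
            Real.cosh (q - a) + k * Real.sinh (q - a) ≤ T} :=
            measurableSet_le_and_le (by fun_prop) (by fun_prop)
        have h1 : ∀ a, H (a, q - a) = ({a : ℝ | Real.cosh a - k * Real.sinh a ≤ T ∧
            Real.cosh (q - a) + k * Real.sinh (q - a) ≤ T}).indicator
            (fun _ => ENNReal.ofReal (Real.sinh q ^ m)) a := fun a => by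
          simp only [hH, Set.indicator, Set.mem_ofPred_eq, add_sub_cancel]
        simp only [h1]
        rw [lintegral_indicator_const hset, Measure.restrict_apply hset, Set.inter_comm]
        rfl

end RayIntegral

/-! ### The load density in hyperbolic polar coordinates -/

noncomputable section LoadFormula

variable {n : ℕ} {R : ℝ}

/-- The linear map `κ (id + (κ - 1) e ⊗ e)`; for a unit vector `e` and `κ = √(1 - p²)` it maps
Euclidean unit vectors to hyperbolic unit vectors at the point `p e`. -/
def kleinFrame {V : Type*} [NormedAddCommGroup V] [InnerProductSpace ℝ V] (κ : ℝ) (e : V) :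
    V →ₗ[ℝ] V :=
  κ • LinearMap.transvection (innerₗ V e) ((κ - 1) • e)

section

variable {V : Type*} [NormedAddCommGroup V] [InnerProductSpace ℝ V]

theorem kleinFrame_apply (κ : ℝ) (e y : V) :
    kleinFrame κ e y = κ • (y + inner ℝ e y • (κ - 1) • e) := by
  simp [kleinFrame, LinearMap.transvection.apply]

/-- The scalar `κ` contributes one factor per dimension, and stretching the unit direction `e` by
`κ` contributes the extra one. -/
theorem det_kleinFrame [FiniteDimensional ℝ V] (κ : ℝ) {e : V} (he : ‖e‖ = 1) :
    LinearMap.det (kleinFrame κ e) = κ ^ (Module.finrank ℝ V + 1) := by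
  rw [kleinFrame, LinearMap.det_smul, LinearMap.transvection.det]
  simp [he, pow_succ]

theorem lintegral_kleinFrame [FiniteDimensional ℝ V] [MeasurableSpace V] [BorelSpace V]
    (μ : Measure V) [μ.IsAddHaarMeasure] {κ : ℝ} (hκ : 0 < κ) {e : V} (he : ‖e‖ = 1)
    {f : V → ℝ≥0∞} (hf : Measurable f) :
    ∫⁻ v, f v ∂μ
      = ENNReal.ofReal (κ ^ (Module.finrank ℝ V + 1)) * ∫⁻ y, f (kleinFrame κ e y) ∂μ := by
  have hdet := det_kleinFrame κ he
  have hpos : 0 < κ ^ (Module.finrank ℝ V + 1) := by positivity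
  have hmap := Measure.map_linearMap_addHaar_eq_smul_addHaar μ (f := kleinFrame κ e)
    (by rw [hdet]; exact hpos.ne')
  rw [← lintegral_map hf (kleinFrame κ e).continuous_of_finiteDimensional.measurable, hmap,
    lintegral_smul_measure, smul_eq_mul, ← mul_assoc, ← ENNReal.ofReal_mul hpos.le, hdet,
    abs_of_pos (inv_pos.2 hpos), mul_inv_cancel₀ hpos.ne', ENNReal.ofReal_one, one_mul]

variable {p : ℝ} {e u : V}

theorem kleinGap_smul (he : ‖e‖ = 1) : kleinGap (p • e) = 1 - p ^ 2 := by
  simp [kleinGap, norm_smul, he]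

theorem inner_kleinFrame (he : ‖e‖ = 1) (κ : ℝ) :
    inner ℝ (p • e) (kleinFrame κ e u) = κ ^ 2 * (p * inner ℝ e u) := by
  rw [kleinFrame_apply]
  simp only [inner_smul_right, inner_add_right, real_inner_smul_left, real_inner_self_eq_norm_sq,
    he]
  ring

theorem norm_sq_kleinFrame (he : ‖e‖ = 1) (hu : ‖u‖ = 1) (κ : ℝ) :
    ‖kleinFrame κ e u‖ ^ 2 = κ ^ 2 * (1 + (κ ^ 2 - 1) * inner ℝ e u ^ 2) := by
  rw [kleinFrame_apply]
  simp only [norm_smul, mul_pow, norm_add_sq_real, inner_smul_right, Real.norm_eq_abs, sq_abs, he,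
    hu, real_inner_comm e u]
  ring

theorem kleinSpeed_kleinFrame (he : ‖e‖ = 1) (hu : ‖u‖ = 1) (hp : 0 < 1 - p ^ 2) :
    kleinSpeed (p • e) (kleinFrame (√(1 - p ^ 2)) e u) = 1 - p ^ 2 := by
  rw [kleinSpeed, norm_sq_kleinFrame he hu, inner_kleinFrame he, kleinGap_smul he,
    Real.sq_sqrt hp.le, ← Real.sqrt_sq hp.le]
  congr 1
  rw [Real.sqrt_sq hp.le]
  ring

theorem kleinGap_kleinFrame (he : ‖e‖ = 1) (hu : ‖u‖ = 1) (hp : 0 < 1 - p ^ 2) (σ : ℝ) :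
    kleinGap (p • e + σ • kleinFrame (√(1 - p ^ 2)) e u)
      = (1 - p ^ 2) * ((1 - p * inner ℝ e u * σ) ^ 2 - σ ^ 2) := by
  rw [kleinGap_add_smul, norm_sq_kleinFrame he hu, inner_kleinFrame he, kleinGap_smul he,
    Real.sq_sqrt hp.le]
  ring

theorem abs_mul_inner_lt_one (he : ‖e‖ = 1) (hu : ‖u‖ = 1) (hp : |p| < 1) :
    |p * inner ℝ e u| < 1 := by
  have h := abs_real_inner_le_norm e u
  rw [he, hu, one_mul] at h
  rw [abs_mul]
  exact (mul_le_of_le_one_right (abs_nonneg _) h).trans_lt hp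

end

/-- The measure of the set of possible distances `a` from `s` to the point at distance `artanh p`
from the origin, over chords of `B_R(0)` of length `q` through that point whose direction makes an
angle of cosine `c` with the radial direction. -/
def chordPositions (R p c q : ℝ) : ℝ≥0∞ :=
  volume {a ∈ Set.Ioo 0 q |
    Real.cosh a - p * c * Real.sinh a ≤ √(1 - p ^ 2) * Real.cosh R ∧
      Real.cosh (q - a) + p * c * Real.sinh (q - a) ≤ √(1 - p ^ 2) * Real.cosh R}

/-- The frame at `p e` turns the integral over `v` into one over Euclidean unit vectors `u`, with
`⟨e, u⟩` the cosine of the hyperbolic angle to the radial direction. Afterwards `p` enters only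
through `chordPositions`, which is what permits a pointwise comparison. -/
theorem hypLoadDensity_smul_eq {m : ℕ} (hR : 0 ≤ R) {p : ℝ} (hp : |p| < 1)
    {e : EuclideanSpace ℝ (Fin (m + 1))} (he : ‖e‖ = 1) :
    hypLoadDensity (m + 1) R (p • e)
      = ∫⁻ u : Metric.sphere (0 : EuclideanSpace ℝ (Fin (m + 1))) 1, (∫⁻ q in Set.Ioi (0 : ℝ),
          ENNReal.ofReal (Real.sinh q ^ m) * chordPositions R p (inner ℝ e u) q)
          ∂(volume : Measure (EuclideanSpace ℝ (Fin (m + 1)))).toSphere := by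
  have hW := measurable_ballWeight (n := m + 1) hR
  have hg : 0 < 1 - p ^ 2 := by nlinarith [sq_abs p, abs_nonneg p]
  have hκ : 0 < √(1 - p ^ 2) := Real.sqrt_pos.2 hg
  set f : EuclideanSpace ℝ (Fin (m + 1)) → ℝ≥0∞ := fun v => ∫⁻ τ in Set.Icc (0 : ℝ) 1,
    ballWeight (m + 1) R (p • e - τ • v) * ballWeight (m + 1) R (p • e + (1 - τ) • v) *
      ENNReal.ofReal (kleinSpeed (p • e) v / kleinGap (p • e)) with hf
  have hfm : Measurable f := by
    refine Measurable.lintegral_prod_right ?_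
    fun_prop
  have hN : Measurable (kleinFrame (√(1 - p ^ 2)) e) :=
    (kleinFrame (√(1 - p ^ 2)) e).continuous_of_finiteDimensional.measurable
  have hsphere : ∀ u : Metric.sphere (0 : EuclideanSpace ℝ (Fin (m + 1))) 1,
      ∫⁻ r in Set.Ioi (0 : ℝ), ENNReal.ofReal
        (r ^ (Module.finrank ℝ (EuclideanSpace ℝ (Fin (m + 1))) - 1)) *
          f (kleinFrame (√(1 - p ^ 2)) e (r • (u : EuclideanSpace ℝ (Fin (m + 1)))))
      = ENNReal.ofReal ((1 - p ^ 2) ^ (-(((m + 1 : ℕ) : ℝ) + 1) / 2)) ^ 2 *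
        ∫⁻ q in Set.Ioi (0 : ℝ), ENNReal.ofReal (Real.sinh q ^ m) *
          chordPositions R p (inner ℝ e u) q := fun u => by
    have hu : ‖(u : EuclideanSpace ℝ (Fin (m + 1)))‖ = 1 := by simp
    simp only [map_smul, finrank_euclideanSpace_fin, Nat.add_sub_cancel]
    exact lintegral_ray hR hg (abs_mul_inner_lt_one he hu hp) (kleinGap_smul he)
      (kleinSpeed_kleinFrame he hu hg) (kleinGap_kleinFrame he hu hg)
  -- With `n = m + 1`, the exponents of `1 - p²` are `(n + 1) / 2` from the determinant, `-(n + 1)`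
  -- from the two endpoint densities, and `(n + 1) / 2` from passing to hyperbolic volume.
  have hc : ENNReal.ofReal (√(1 - p ^ 2) ^ (m + 1 + 1)) *
      ENNReal.ofReal ((1 - p ^ 2) ^ (-(((m + 1 : ℕ) : ℝ) + 1) / 2)) ^ 2 *
      ENNReal.ofReal ((1 - p ^ 2) ^ ((((m + 1 : ℕ) : ℝ) + 1) / 2)) = 1 := by
    rw [← ENNReal.ofReal_pow (by positivity), ← ENNReal.ofReal_mul (by positivity),
      ← ENNReal.ofReal_mul (by positivity), ← Real.rpow_natCast (√(1 - p ^ 2)), Real.sqrt_eq_rpow,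
      ← Real.rpow_mul hg.le, sq ((1 - p ^ 2) ^ (-(((m + 1 : ℕ) : ℝ) + 1) / 2)), ← Real.rpow_add hg, ← Real.rpow_add hg, ← Real.rpow_add hg,
      ← ENNReal.ofReal_one]
    congr 1
    refine (congrArg _ ?_).trans (Real.rpow_zero (1 - p ^ 2))
    push_cast
    ring
  rw [hypLoadDensity, loadDensity]
  change (∫⁻ v, f v) * ENNReal.ofReal (kleinGap (p • e) ^ _) = _
  have hpolar := lintegral_eq_lintegral_sphere_Ioi volume (hfm.comp hN)
  simp only [Function.comp_apply, hsphere] at hpolar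
  rw [kleinGap_smul he, lintegral_kleinFrame volume hκ he hfm, hpolar, lintegral_const_mul' _ _ (by finiteness), finrank_euclideanSpace_fin, ← mul_assoc,
    mul_right_comm, hc, one_mul]

theorem hypDist_isometry (U : EuclideanSpace ℝ (Fin n) ≃ₗᵢ[ℝ] EuclideanSpace ℝ (Fin n))
    (x y : EuclideanSpace ℝ (Fin n)) : hypDist (U x) (U y) = hypDist x y := by
  simp [hypDist]

theorem ballWeight_isometry (U : EuclideanSpace ℝ (Fin n) ≃ₗᵢ[ℝ] EuclideanSpace ℝ (Fin n))
    (x : EuclideanSpace ℝ (Fin n)) : ballWeight n R (U x) = ballWeight n R x := by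
  have h : U x ∈ hypBall n R ↔ x ∈ hypBall n R := by
    have := hypDist_isometry U 0 x
    rw [map_zero] at this
    simp only [hypBall, Set.mem_ofPred_eq, mem_hypSpace_iff, U.norm_map, this]
  by_cases hx : x ∈ hypBall n R
  · simp [ballWeight, h, hx, hypWeight, kleinGap]
  · simp [ballWeight, h, hx]

theorem hypLoadDensity_isometry (U : EuclideanSpace ℝ (Fin n) ≃ₗᵢ[ℝ] EuclideanSpace ℝ (Fin n))
    (z : EuclideanSpace ℝ (Fin n)) : hypLoadDensity n R (U z) = hypLoadDensity n R z := by
  have hgap : kleinGap (U z) = kleinGap z := by simp [kleinGap]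
  rw [hypLoadDensity, hypLoadDensity, hgap, loadDensity, loadDensity,
    ← U.measurePreserving.lintegral_comp_emb U.toHomeomorph.measurableEmbedding]
  congr 1
  refine lintegral_congr fun v => lintegral_congr fun τ => ?_
  have hspeed : kleinSpeed (U z) (U v) = kleinSpeed z v := by simp [kleinSpeed, hgap]
  rw [← map_smul, ← map_smul, ← map_sub, ← map_add, ballWeight_isometry, ballWeight_isometry,
    hgap, hspeed]

/-- The reflection in the hyperplane orthogonal to `x - y` carries `x` to `y`. -/
theorem hypLoadDensity_eq_of_norm_eq {x y : EuclideanSpace ℝ (Fin n)} (h : ‖x‖ = ‖y‖) :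
    hypLoadDensity n R x = hypLoadDensity n R y := by
  rw [← hypLoadDensity_isometry ((ℝ ∙ (x - y))ᗮ.reflection) x, Submodule.reflection_sub h]

end LoadFormula

/-! ### Monotonicity of the density in the distance from the origin -/

section Monotone

/-- Completing to `cosh (a - m) / cosh m` recentres the parameter at the foot of the perpendicular
from the origin. -/
theorem cosh_sub_mul_sinh_le_iff {k m A : ℝ} (hm : Real.tanh m = k) (a : ℝ) :
    Real.cosh a - k * Real.sinh a ≤ A ↔ Real.cosh (a - m) ≤ A * Real.cosh m := by
  have hc := Real.cosh_pos m
  rw [← div_le_iff₀ hc, Real.cosh_sub, ← hm, Real.tanh_eq_sinh_div_cosh]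
  have : (Real.cosh a * Real.cosh m - Real.sinh a * Real.sinh m) / Real.cosh m
      = Real.cosh a - Real.sinh m / Real.cosh m * Real.sinh a := by field_simp
  rw [this]

/-- Both endpoints lie on the chord of half-length `C` cut out by the ball, whose ends have signed
distances `C + m` behind the point and `C - m` ahead of it. Hence `a ≤ C + m` and `q - a ≤ C - m`,
besides `0 < a < q`. -/
theorem chordPositions_eq {R p c q m C : ℝ} (hm : Real.tanh m = p * c) (hC : 0 ≤ C)
    (hCm : Real.cosh C = √(1 - p ^ 2) * Real.cosh R * Real.cosh m) :
    chordPositions R p c q = ENNReal.ofReal (min q (C + m) + min q (C - m) - q) := by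
  have hset : {a ∈ Set.Ioo 0 q |
      Real.cosh a - p * c * Real.sinh a ≤ √(1 - p ^ 2) * Real.cosh R ∧
      Real.cosh (q - a) + p * c * Real.sinh (q - a) ≤ √(1 - p ^ 2) * Real.cosh R}
      = Set.Ioo 0 q ∩ Set.Icc (m + q - C) (m + C) := by
    ext a
    have h1 : Real.cosh (q - a) + p * c * Real.sinh (q - a)
        = Real.cosh (q - a) - -(p * c) * Real.sinh (q - a) := by ring
    have h2 : Real.tanh (-m) = -(p * c) := by rw [Real.tanh_neg, hm]
    simp only [Set.mem_ofPred_eq, Set.mem_inter_iff, Set.mem_Icc, Set.mem_Ioo]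
    rw [h1, cosh_sub_mul_sinh_le_iff hm, cosh_sub_mul_sinh_le_iff h2, Real.cosh_neg, ← hCm,
      Real.cosh_le_cosh, Real.cosh_le_cosh, abs_of_nonneg hC, abs_le, abs_le]
    constructor
    · rintro ⟨⟨_, _⟩, ⟨_, _⟩, _, _⟩
      exact ⟨⟨by linarith, by linarith⟩, by linarith, by linarith⟩
    · rintro ⟨⟨_, _⟩, _, _⟩
      exact ⟨⟨by linarith, by linarith⟩, ⟨by linarith, by linarith⟩, by linarith, by linarith⟩
  have hval : min q (C + m) + min q (C - m) - q = min q (m + C) - max 0 (m + q - C) := by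
    rcases le_total q (C - m) with h | h
    · rw [min_eq_left h, max_eq_left (by linarith), add_comm C m]; ring
    · rw [min_eq_right h, max_eq_right (by linarith), add_comm C m]; ring
  rw [chordPositions, hset, hval]
  apply le_antisymm
  · refine (measure_mono (t := Set.Icc (max 0 (m + q - C)) (min q (m + C))) ?_).trans_eq
      Real.volume_Icc
    rintro a ⟨⟨h1, h2⟩, h3, h4⟩
    exact ⟨max_le h1.le h3, le_min h2.le h4⟩
  · rw [← Real.volume_Ioo]
    refine measure_mono ?_
    rintro a ⟨h1, h2⟩
    exact ⟨⟨(le_max_left _ _).trans_lt h1, h2.trans_le (min_le_left _ _)⟩,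
      ((le_max_right _ _).trans_lt h1).le, (h2.trans_le (min_le_right _ _)).le⟩

/-- `min q` is nondecreasing and concave, so the symmetric sum grows with `C` and decreases as `|m|`
grows. -/
theorem overlap_le_overlap {q m m' C C' : ℝ} (hm : |m| ≤ |m'|) (hC : C' ≤ C) :
    min q (C' + m') + min q (C' - m') - q ≤ min q (C + m) + min q (C - m) - q := by
  obtain ⟨h1, h2⟩ := abs_le.1 hm
  rcases abs_cases m' with ⟨h, -⟩ | ⟨h, -⟩ <;> rw [h] at h1 h2 <;>
    rcases min_cases q (C' + m') with ⟨h3, _⟩ | ⟨h3, _⟩ <;>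
    rcases min_cases q (C' - m') with ⟨h4, _⟩ | ⟨h4, _⟩ <;>
    rcases min_cases q (C + m) with ⟨h5, _⟩ | ⟨h5, _⟩ <;>
    rcases min_cases q (C - m) with ⟨h6, _⟩ | ⟨h6, _⟩ <;>
    rw [h3, h4, h5, h6] <;> linarith

theorem cosh_artanh_sq {x : ℝ} (hx : |x| < 1) : Real.cosh (Real.artanh x) ^ 2 = (1 - x ^ 2)⁻¹ := by
  have h : 0 < 1 - x ^ 2 := by nlinarith [sq_abs x, abs_nonneg x]
  rw [Real.cosh_artanh (abs_lt.1 hx), div_pow, Real.sq_sqrt h.le, one_pow, one_div]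

/-- Moving the point away from the origin, with the angle of the chord to the radial direction
fixed, leaves less room for chords of a given length. -/
theorem chordPositions_anti {R p p' c q : ℝ} (hp : 0 ≤ p) (hpp : p ≤ p') (hp' : p' < 1)
    (hc : |c| ≤ 1) : chordPositions R p' c q ≤ chordPositions R p c q := by
  have hsq : p ^ 2 ≤ p' ^ 2 := by gcongr
  have hsq' : p' ^ 2 < 1 := by nlinarith
  have hc2 : c ^ 2 ≤ 1 := by rw [← sq_abs]; nlinarith [abs_nonneg c]
  have hk : ∀ {x : ℝ}, 0 ≤ x → x < 1 → |x * c| < 1 := fun h0 h1 => by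
    rw [abs_mul, abs_of_nonneg h0]
    exact (mul_le_of_le_one_right h0 hc).trans_lt h1
  have hk1 := hk hp (hpp.trans_lt hp')
  have hk2 := hk (hp.trans hpp) hp'
  have hm1 := cosh_artanh_sq hk1
  have hm2 := cosh_artanh_sq hk2
  have ht1 := Real.tanh_artanh (abs_lt.1 hk1)
  have ht2 := Real.tanh_artanh (abs_lt.1 hk2)
  set m := Real.artanh (p * c)
  set m' := Real.artanh (p' * c)
  have hd1 : 0 < 1 - (p * c) ^ 2 := by nlinarith [sq_abs (p * c), abs_nonneg (p * c)]
  have hd2 : 0 < 1 - (p' * c) ^ 2 := by nlinarith [sq_abs (p' * c), abs_nonneg (p' * c)]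
  have hmm : |m| ≤ |m'| := by
    rw [← Real.cosh_le_cosh, ← sq_le_sq₀ (Real.cosh_pos _).le (Real.cosh_pos _).le, hm1, hm2]
    refine inv_anti₀ hd2 ?_
    nlinarith [sq_nonneg c]
  -- The square of this quantity is `cosh² R (1 - p²) / (1 - p² c²)`, nonincreasing in `p` because
  -- `c² ≤ 1`.
  have hΓ : √(1 - p' ^ 2) * Real.cosh R * Real.cosh m'
      ≤ √(1 - p ^ 2) * Real.cosh R * Real.cosh m := by
    have h1 := Real.cosh_pos R
    have h2 := Real.cosh_pos m
    have h3 := Real.cosh_pos m'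
    rw [← sq_le_sq₀ (by positivity) (by positivity)]
    simp only [mul_pow]
    rw [hm1, hm2, Real.sq_sqrt (by linarith), Real.sq_sqrt (by linarith), ← div_eq_mul_inv,
      ← div_eq_mul_inv, div_le_div_iff₀ hd2 hd1]
    have h4 : (1 - p' ^ 2) * (1 - (p * c) ^ 2) ≤ (1 - p ^ 2) * (1 - (p' * c) ^ 2) := by
      nlinarith [mul_nonneg (sub_nonneg.2 hsq) (sub_nonneg.2 hc2)]
    nlinarith [mul_le_mul_of_nonneg_left h4 (sq_nonneg (Real.cosh R))]
  by_cases h1 : 1 ≤ √(1 - p' ^ 2) * Real.cosh R * Real.cosh m'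
  · rw [chordPositions_eq ht2 (Real.arcosh_nonneg h1) (Real.cosh_arcosh h1),
      chordPositions_eq ht1 (Real.arcosh_nonneg (h1.trans hΓ)) (Real.cosh_arcosh (h1.trans hΓ))]
    refine ENNReal.ofReal_le_ofReal (overlap_le_overlap hmm ?_)
    rwa [Real.arcosh_le_arcosh (by linarith) (by linarith)]
  -- Here the line through the outer point misses the ball, so no position is admissible.
  · refine le_of_eq_of_le ?_ zero_le
    rw [chordPositions]
    convert measure_empty (μ := (volume : Measure ℝ))
    refine Set.eq_empty_of_forall_notMem ?_
    rintro a ⟨-, h, -⟩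
    rw [cosh_sub_mul_sinh_le_iff ht2] at h
    exact h1 ((Real.one_le_cosh _).trans h)

theorem hypLoadDensity_anti {n : ℕ} (hn : 1 ≤ n) {R : ℝ} (hR : 0 ≤ R)
    {x y : EuclideanSpace ℝ (Fin n)} (hxy : ‖x‖ ≤ ‖y‖) (hy : ‖y‖ < 1) :
    hypLoadDensity n R y ≤ hypLoadDensity n R x := by
  obtain ⟨m, rfl⟩ := Nat.exists_eq_add_of_le' hn
  obtain ⟨e, he⟩ := exists_norm_eq (EuclideanSpace ℝ (Fin (m + 1))) zero_le_one
  have hx : hypLoadDensity (m + 1) R x = hypLoadDensity (m + 1) R (‖x‖ • e) :=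
    hypLoadDensity_eq_of_norm_eq (by simp [norm_smul, he])
  have hy' : hypLoadDensity (m + 1) R y = hypLoadDensity (m + 1) R (‖y‖ • e) :=
    hypLoadDensity_eq_of_norm_eq (by simp [norm_smul, he])
  rw [hx, hy', hypLoadDensity_smul_eq hR (by rw [abs_norm]; exact hy) he,
    hypLoadDensity_smul_eq hR (by rw [abs_norm]; exact hxy.trans_lt hy) he]
  refine lintegral_mono fun u => setLIntegral_mono' measurableSet_Ioi fun q hq => ?_
  have hc : |inner ℝ e (u : EuclideanSpace ℝ (Fin (m + 1)))| ≤ 1 := by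
    have := abs_real_inner_le_norm e (u : EuclideanSpace ℝ (Fin (m + 1)))
    simpa [he] using this
  gcongr
  exact chordPositions_anti (norm_nonneg x) hxy hy hc

end Monotone

/-! ### The bathtub principle, volumes of balls and the conclusion -/

section Bathtub

/-- Removing the common part leaves `A \ B` and `B \ A` of equal measure, and the supremum of `ρ`
over `A \ B` is a constant separating the values on the two. -/
theorem setLIntegral_le_of_measure_eq {α : Type*} [MeasurableSpace α] {μ : Measure α} {A B : Set α}
    (hA : MeasurableSet A) (hB : MeasurableSet B) (hAB : μ A = μ B) (hfin : μ B ≠ ∞)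
    {ρ : α → ℝ≥0∞} (hρ : ∀ x ∈ B, ∀ y ∈ A \ B, ρ y ≤ ρ x) :
    ∫⁻ x in A, ρ x ∂μ ≤ ∫⁻ x in B, ρ x ∂μ := by
  have hdiff : μ (A \ B) = μ (B \ A) := by
    have h1 := measure_inter_add_sdiff (μ := μ) A hB
    have h2 := measure_inter_add_sdiff (μ := μ) B hA
    rw [Set.inter_comm] at h2
    have hi : μ (A ∩ B) ≠ ∞ := ((measure_mono Set.inter_subset_right).trans_lt hfin.lt_top).ne
    exact (ENNReal.add_right_inj hi).1 (h1.trans (hAB.trans h2.symm))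
  rw [← lintegral_inter_add_sdiff ρ A hB, ← lintegral_inter_add_sdiff ρ B hA, Set.inter_comm B A]
  gcongr 1
  calc ∫⁻ x in A \ B, ρ x ∂μ ≤ ∫⁻ _ in A \ B, (⨆ y ∈ A \ B, ρ y) ∂μ :=
        setLIntegral_mono' (hA.diff hB) fun y hy => le_iSup₂ (f := fun y (_ : y ∈ A \ B) => ρ y) y hy
    _ = ∫⁻ _ in B \ A, (⨆ y ∈ A \ B, ρ y) ∂μ := by
        rw [setLIntegral_const, setLIntegral_const, hdiff]
    _ ≤ ∫⁻ x in B \ A, ρ x ∂μ :=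
        setLIntegral_mono' (hB.diff hA) fun x hx => iSup₂_le fun y hy => hρ x hx.1 y hy

variable {n : ℕ} {R r : ℝ}

theorem isHypConvex_hypBall (hr : 0 ≤ r) : IsHypConvex (hypBall n r) := by
  refine ⟨hypBall_subset_hypSpace, fun s hs t ht z hz => ?_⟩
  obtain ⟨τ, hτ, rfl⟩ := (mem_geodSegment_iff (mem_hypSpace_iff.1 hs.1)
    (mem_hypSpace_iff.1 ht.1)).1 hz
  rw [hypBall_eq_closedBall hr] at hs ht ⊢
  exact (convex_closedBall _ _).add_smul_sub_mem hs ht hτ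

theorem mem_hypBall_iff_norm {x : EuclideanSpace ℝ (Fin n)} (hr : 0 ≤ r) :
    x ∈ hypBall n r ↔ ‖x‖ ≤ Real.tanh r := by
  rw [hypBall_eq_closedBall hr, mem_closedBall_zero_iff]

theorem hypBall_mono (h : r ≤ R) : hypBall n r ⊆ hypBall n R :=
  fun _ hx => ⟨hx.1, hx.2.trans h⟩

theorem hypVolume_absolutelyContinuous : hypVolume n ≪ volume :=
  (withDensity_absolutelyContinuous _ _).trans Measure.absolutelyContinuous_restrict

theorem hypVolume_hypBall_lt_top (hR : 0 ≤ R) : hypVolume n (hypBall n R) < ∞ := by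
  have hB := measurableSet_hypBall (n := n) hR
  rw [← Measure.restrict_apply_self, hypVolume_restrict hB hypBall_subset_hypSpace,
    withDensity_apply _ hB, Measure.restrict_restrict hB, Set.inter_self]
  have hc := Real.cosh_pos R
  calc ∫⁻ x in hypBall n R, hypWeight n x
      ≤ ∫⁻ _ in hypBall n R, ENNReal.ofReal (((Real.cosh R ^ 2)⁻¹) ^ (-((n : ℝ) + 1) / 2)) := by
        refine setLIntegral_mono' hB fun x hx => ENNReal.ofReal_le_ofReal ?_
        refine Real.rpow_le_rpow_of_nonpos (by positivity) ?_ ?_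
        · rw [inv_eq_one_div, div_le_iff₀' (by positivity)]
          exact (mem_hypBall_iff hR).1 hx
        · have : (0 : ℝ) ≤ n := n.cast_nonneg
          linarith
    _ < ∞ := by
        rw [setLIntegral_const, hypBall_eq_closedBall hR]
        exact ENNReal.mul_lt_top ENNReal.ofReal_lt_top measure_closedBall_lt_top

theorem hypVolume_hypBall_zero (hn : 1 ≤ n) : hypVolume n (hypBall n 0) = 0 := by
  have : Nonempty (Fin n) := ⟨⟨0, hn⟩⟩
  apply hypVolume_absolutelyContinuous
  rw [hypBall_eq_closedBall le_rfl, Real.tanh_zero, Metric.closedBall_zero]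
  exact measure_singleton _

/-- As `r → r₀` the indicators of the balls converge off the sphere of radius `tanh r₀`, which is
null; the indicator of `B_R(0)` dominates. -/
theorem continuousOn_hypVolume_hypBall (hn : 1 ≤ n) (hR : 0 ≤ R) :
    ContinuousOn (fun r => hypVolume n (hypBall n r)) (Set.Icc 0 R) := by
  have : Nonempty (Fin n) := ⟨⟨0, hn⟩⟩
  have hB : ∀ r ∈ Set.Icc 0 R, MeasurableSet (hypBall n r) := fun r hr => measurableSet_hypBall hr.1
  intro r₀ hr₀
  have hlim : Filter.Tendsto (fun r => ∫⁻ x, (hypBall n r).indicator 1 x ∂(hypVolume n))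
      (nhdsWithin r₀ (Set.Icc 0 R)) (nhds (∫⁻ x, (hypBall n r₀).indicator 1 x ∂(hypVolume n))) := by
    refine tendsto_lintegral_filter_of_dominated_convergence ((hypBall n R).indicator 1) ?_ ?_ ?_ ?_
    · filter_upwards [self_mem_nhdsWithin] with r hr
      exact measurable_one.indicator (hB r hr)
    · filter_upwards [self_mem_nhdsWithin] with r hr
      exact Filter.Eventually.of_forall fun x =>
        Set.indicator_le_indicator_of_subset (hypBall_mono hr.2) (fun _ => zero_le) x
    · rw [lintegral_indicator_one (measurableSet_hypBall hR)]
      exact (hypVolume_hypBall_lt_top hR).ne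
    · have hsphere : hypVolume n (Metric.sphere 0 (Real.tanh r₀)) = 0 :=
        hypVolume_absolutelyContinuous (Measure.addHaar_sphere _ _ _)
      filter_upwards [measure_eq_zero_iff_ae_notMem.1 hsphere] with x hx
      have htanh : Filter.Tendsto Real.tanh (nhdsWithin r₀ (Set.Icc 0 R)) (nhds (Real.tanh r₀)) := by
        have hcont : Continuous Real.tanh := by
          simp only [funext Real.tanh_eq_sinh_div_cosh]
          exact Real.continuous_sinh.div₀ Real.continuous_cosh fun x => (Real.cosh_pos x).ne'
        exact hcont.continuousAt.continuousWithinAt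
      refine tendsto_const_nhds.congr' ?_
      rw [mem_sphere_zero_iff_norm] at hx
      rcases lt_or_gt_of_ne hx with h | h
      · filter_upwards [self_mem_nhdsWithin, htanh.eventually_const_lt h] with r hr hlt
        rw [Set.indicator_of_mem ((mem_hypBall_iff_norm hr₀.1).2 h.le),
          Set.indicator_of_mem ((mem_hypBall_iff_norm hr.1).2 hlt.le)]
      · filter_upwards [self_mem_nhdsWithin, htanh.eventually_lt_const h] with r hr hlt
        rw [Set.indicator_of_notMem (mt (mem_hypBall_iff_norm hr₀.1).1 h.not_ge),
          Set.indicator_of_notMem (mt (mem_hypBall_iff_norm hr.1).1 hlt.not_ge)]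
  rw [lintegral_indicator_one (hB r₀ hr₀)] at hlim
  refine hlim.congr' ?_
  filter_upwards [self_mem_nhdsWithin] with r hr
  exact lintegral_indicator_one (hB r hr)

theorem exists_hypVolume_hypBall_eq (hn : 1 ≤ n) (hR : 0 ≤ R) {v : ℝ≥0∞}
    (hv : v ≤ hypVolume n (hypBall n R)) : ∃ r ∈ Set.Icc 0 R, hypVolume n (hypBall n r) = v :=
  intermediate_value_Icc hR (continuousOn_hypVolume_hypBall hn hR)
    ⟨by simp [hypVolume_hypBall_zero hn], hv⟩

theorem lengthInter_mono {X Y : Set (EuclideanSpace ℝ (Fin n))} (h : X ⊆ Y)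
    (s t : EuclideanSpace ℝ (Fin n)) : lengthInter X s t ≤ lengthInter Y s t :=
  measure_mono (Set.image_mono (Set.inter_subset_inter_left _ h))

theorem trafficLoad_mono {X Y : Set (EuclideanSpace ℝ (Fin n))} (h : X ⊆ Y) :
    trafficLoad n R X ≤ trafficLoad n R Y :=
  lintegral_mono fun p => lengthInter_mono h p.1 p.2

theorem trafficLoad_le_of_hypVolume_eq (hn : 1 ≤ n) (hR : 0 ≤ R) (hr : 0 ≤ r)
    {X : Set (EuclideanSpace ℝ (Fin n))} (hX : X ⊆ hypSpace n)
    (hvol : hypVolume n X = hypVolume n (hypBall n r)) :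
    trafficLoad n R X ≤ trafficLoad n R (hypBall n r) := by
  -- The density formula needs a measurable set, so `X` is replaced by a measurable hull of the same
  -- volume, which can only raise the load.
  set Y := toMeasurable (hypVolume n) X ∩ hypSpace n with hY
  have hYm : MeasurableSet Y := (measurableSet_toMeasurable _ _).inter measurableSet_hypSpace
  have hXY : X ⊆ Y := Set.subset_inter (subset_toMeasurable _ _) hX
  have hYv : hypVolume n Y = hypVolume n (hypBall n r) := by
    rw [← hvol]
    refine le_antisymm ?_ (measure_mono hXY)
    exact (measure_mono Set.inter_subset_left).trans_eq (measure_toMeasurable X)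
  have hB := measurableSet_hypBall (n := n) hr
  refine (trafficLoad_mono hXY).trans ?_
  rw [trafficLoad_eq_lintegral_hypLoadDensity hR hYm Set.inter_subset_right,
    trafficLoad_eq_lintegral_hypLoadDensity hR hB hypBall_subset_hypSpace]
  refine setLIntegral_le_of_measure_eq hYm hB hYv (hypVolume_hypBall_lt_top hr).ne
    fun x hx y hy => ?_
  have h1 := (mem_hypBall_iff_norm hr).1 hx
  have h2 := lt_of_not_ge (mt (mem_hypBall_iff_norm hr).2 hy.2)
  exact hypLoadDensity_anti hn hR (h1.trans h2.le) (mem_hypSpace_iff.1 hy.1.2)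

end Bathtub

theorem mainTheorem4 (n : ℕ) (hn : 1 ≤ n) (R : ℝ) (hR : 0 < R)
    (v : ℝ≥0∞) (hv : v ≤ hypVolume n (hypBall n R)) :
    ∃ r : ℝ, 0 ≤ r ∧ r ≤ R ∧
      hypBall n r ∈ convexSubsetsOfVolume n R v ∧
      ∀ X ∈ convexSubsetsOfVolume n R v,
        normalizedTrafficLoad n R X ≤ normalizedTrafficLoad n R (hypBall n r) := by
  obtain ⟨r, ⟨hr0, hrR⟩, hrv⟩ := exists_hypVolume_hypBall_eq hn hR.le hv
  refine ⟨r, hr0, hrR, ⟨isHypConvex_hypBall hr0, hypBall_mono hrR, hrv⟩, ?_⟩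
  rintro X ⟨hX, -, hXv⟩
  exact ENNReal.div_le_div_right
    (trafficLoad_le_of_hypVolume_eq hn hR.le hr0 hX.1 (hXv.trans hrv.symm)) _
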